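/- For $n\in\mathbb N$ consider the closed simple walks $w=(p_0,p_1,\dots,p_{2n})$ of length $2n$ on $\mathbb Z$, i.e. $p_0=p_{2n}=0$ and $p_i-p_{i-1}\in\{1,-1\}$, and let $E_n$ denote the average over all of these walks (uniform distribution). For $q\in\mathbb Z$ let $mu(q,w)=\delta_{q,p_0}+\delta_{q,p_{2n}}+2\sum_{i=1}^{2n-1}\delta_{q,p_i}$, let $N_{2k}(w)=\#\{q\in\mathbb Z: mu(q,w)=2k\}$ for $k\ge 1$, and let $ran(w)=\sum_{k\ge1}N_{2k}(w)$ be the range of $w$, which is the number of distinct points visited by $w$. Let $$\xi(s)=s\,(s-1)\,\zeta(s)\,\Gamma(s/2)\,\pi^{-s/2}$$ be Riemann's $\xi$-function, with removable singularities filled in (so that $\xi(0)=\xi(1)=1$). Then for every $r\in\mathbb N=\{0,1,2,\dots\}$, as $n\to\infty$, $$E_n\big(ran(w)^r\big)=\xi(r)\cdot\big(E_n(ran(w))\big)^r\cdot\big(1+O(1/n)\big),$$ where the constant implied by $O$ may depend on $r$. -/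

import Mathlib

open Filter Topology Asymptotics

/-- A simple walk of length `m` on the one-dimensional lattice `ℤ`: a starting point together with
a sequence of `m` steps, each of them `+1` or `-1` (the two units of `ℤ`). -/
structure SimpleWalk (m : ℕ) where
  start : ℤ
  step : Fin m → ℤˣ

namespace SimpleWalk

variable {m : ℕ}

/-- The `i`-th point of the walk (`0 ≤ i ≤ m`): the starting point plus the first `i` steps. -/
def point (w : SimpleWalk m) (i : ℕ) : ℤ :=
  w.start + ∑ j : Fin m, if j.val < i then (w.step j : ℤ) else 0

/-- A walk is closed if its ending point is its starting point. -/
def IsClosed (w : SimpleWalk m) : Prop := w.point m = w.start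

/-- The multiplicity of the point `q`: the number of steps of `w` arriving at `q` plus the number
of steps leaving `q`, that is `δ(q, p₀) + δ(q, pₘ) + 2 ∑_{0 < i < m} δ(q, pᵢ)`. -/
def mu (q : ℤ) (w : SimpleWalk m) : ℕ :=
  (if q = w.point 0 then 1 else 0) + (if q = w.point m then 1 else 0) +
    2 * ∑ i ∈ Finset.Ioo 0 m, if q = w.point i then 1 else 0

/-- The `k`-multiple point range: the number of points of multiplicity `2k`. -/
noncomputable def multiplePointRange (k : ℕ) (w : SimpleWalk m) : ℕ :=
  {q : ℤ | mu q w = 2 * k}.ncard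

/-- The range of a (closed) walk: the sum over all `k ≥ 1` of its `k`-multiple point ranges. Only
finitely many terms are nonzero. -/
noncomputable def ran (w : SimpleWalk m) : ℕ := ∑ᶠ k : ℕ, multiplePointRange (k + 1) w

/-- For a closed walk the range is the number of distinct points visited. -/
theorem ran_eq_card (w : SimpleWalk m) (hw : w.IsClosed) :
    w.ran = ((Finset.range (m + 1)).image w.point).card := by
  classical
  set V := (Finset.range (m + 1)).image w.point with hV
  have h0 : w.point 0 = w.start := by simp [point]
  have heven : ∀ q, mu q w = 2 * (mu q w / 2) := by
    intro q
    have : 2 ∣ mu q w := by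
      unfold mu
      rw [h0, hw]
      split_ifs <;> omega
    omega
  have hpos : ∀ q, mu q w ≠ 0 ↔ q ∈ V := by
    intro q
    constructor
    · intro h
      by_contra hq
      apply h
      have hne : ∀ i, i ≤ m → q ≠ w.point i := by
        intro i hi e
        exact hq (Finset.mem_image.2 ⟨i, Finset.mem_range.2 (by omega), e.symm⟩)
      unfold mu
      rw [if_neg (hne 0 (Nat.zero_le _)), if_neg (hne m le_rfl),
        Finset.sum_eq_zero (fun i hi => if_neg (hne i (Finset.mem_Ioo.1 hi).2.le))]
      norm_num
    · intro h
      obtain ⟨i, hi, e⟩ := Finset.mem_image.1 h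
      have hi' : i ≤ m := by have := Finset.mem_range.1 hi; omega
      unfold mu
      by_cases c0 : q = w.point 0
      · rw [if_pos c0]; omega
      by_cases cm : q = w.point m
      · rw [if_pos cm]; omega
      have hi0 : i ∈ Finset.Ioo 0 m := by
        rw [Finset.mem_Ioo]
        constructor
        · rcases Nat.eq_zero_or_pos i with h | h
          · subst h; exact absurd e.symm c0
          · exact h
        · rcases hi'.eq_or_lt with h | h
          · subst h; exact absurd e.symm cm
          · exact h
      have : 1 ≤ ∑ i ∈ Finset.Ioo 0 m, if q = w.point i then 1 else 0 := by
        refine le_trans ?_ (Finset.single_le_sum (fun _ _ => Nat.zero_le _) hi0)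
        rw [if_pos e.symm]
      omega
  have hN : ∀ k, multiplePointRange (k + 1) w
      = (V.filter (fun q => mu q w / 2 - 1 = k)).card := by
    intro k
    unfold multiplePointRange
    rw [← Set.ncard_coe_finset]
    congr 1
    ext q
    have h1 := heven q
    have h2 := hpos q
    simp only [Set.mem_ofPred_eq, Finset.coe_filter]
    rw [← h2]
    omega
  unfold ran
  simp_rw [hN]
  rw [finsum_eq_sum_of_support_subset (s := V.image (fun q => mu q w / 2 - 1))]
  · exact (Finset.card_eq_sum_card_image _ _).symm
  · intro k hk
    obtain ⟨q, hq⟩ := Finset.card_ne_zero.1 hk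
    rw [Finset.mem_filter] at hq
    exact Finset.mem_coe.2 (Finset.mem_image.2 ⟨q, hq⟩)

end SimpleWalk

/-- The step sequences of the closed walks of length `2n`. -/
def closedSteps (n : ℕ) : Finset (Fin (2 * n) → ℤˣ) :=
  Finset.univ.filter fun s => ∑ j, (s j : ℤ) = 0

theorem mem_closedSteps_iff (n : ℕ) (p : ℤ) (s : Fin (2 * n) → ℤˣ) :
    s ∈ closedSteps n ↔ (SimpleWalk.mk p s).IsClosed := by
  simp [closedSteps, SimpleWalk.IsClosed, SimpleWalk.point]

/-- The expectation `E_n(X)`: the average of `X` over all closed simple walks of length `2n` which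
start (and end) in `0`. -/
noncomputable def closedWalkExpectation (n : ℕ) (X : SimpleWalk (2 * n) → ℝ) : ℝ :=
  (∑ s ∈ closedSteps n, X ⟨0, s⟩) / ((closedSteps n).card : ℝ)

/-- The expression `s (s - 1) ζ(s) Γ(s/2) π^(-s/2)`. -/
noncomputable def xiFormula (s : ℂ) : ℂ :=
  s * (s - 1) * riemannZeta s * Complex.Gamma (s / 2) * (Real.pi : ℂ) ^ (-s / 2)

/-- Riemann's `ξ`-function `ξ(s) = s (s - 1) ζ(s) Γ(s/2) π^(-s/2)`, where the removable
singularities of the right-hand side (in particular `s = 0` and `s = 1`) are filled in. -/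
noncomputable def riemannXi (s : ℂ) : ℂ := limUnder (𝓝[≠] s) xiFormula

theorem xiFormula_eq_of_Gammaℝ_ne_zero {s : ℂ} (h0 : s ≠ 0) (h1 : s ≠ 1)
    (hG : Complex.Gammaℝ s ≠ 0) : xiFormula s = s * (s - 1) * completedRiemannZeta₀ s + 1 := by
  have h1' : (1 : ℂ) - s ≠ 0 := sub_ne_zero.2 (Ne.symm h1)
  have e : xiFormula s = s * (s - 1) * (riemannZeta s * Complex.Gammaℝ s) := by
    unfold xiFormula Complex.Gammaℝ; ring
  rw [e, riemannZeta_def_of_ne_zero h0, div_mul_cancel₀ _ hG, completedRiemannZeta_eq]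
  field_simp
  ring

/-- The limit defining `ξ(s)` exists at every `s`. -/
theorem tendsto_xiFormula (s : ℂ) :
    Tendsto xiFormula (𝓝[≠] s) (𝓝 (s * (s - 1) * completedRiemannZeta₀ s + 1)) := by
  have hc : Continuous fun z : ℂ => z * (z - 1) * completedRiemannZeta₀ z + 1 := by
    have := differentiable_completedZeta₀.continuous
    fun_prop
  refine ((hc.tendsto s).mono_left nhdsWithin_le_nhds).congr' ?_
  have hne : ∀ c : ℂ, ∀ᶠ z in 𝓝[≠] s, z ≠ c := fun c => by
    by_cases h : c = s
    · subst h; exact self_mem_nhdsWithin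
    · exact nhdsWithin_le_nhds (isOpen_ne.mem_nhds (Ne.symm h))
  have hG : ∀ᶠ z in 𝓝[≠] s, Complex.Gammaℝ z ≠ 0 := by
    have ha : AnalyticOnNhd ℂ (fun z => (Complex.Gammaℝ z)⁻¹) Set.univ :=
      fun z _ => Complex.differentiable_Gammaℝ_inv.analyticAt z
    rcases (ha s trivial).eventually_eq_zero_or_eventually_ne_zero with h | h
    · exfalso
      have := ha.eqOn_zero_of_preconnected_of_eventuallyEq_zero isPreconnected_univ trivial h
        (Set.mem_univ (1 : ℂ))
      simp [Complex.Gammaℝ_one] at this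
    · filter_upwards [h] with z hz h0
      exact hz (by rw [h0, inv_zero])
  filter_upwards [hne 0, hne 1, hG] with z h0 h1 h2
  exact (xiFormula_eq_of_Gammaℝ_ne_zero h0 h1 h2).symm

theorem riemannXi_eq (s : ℂ) : riemannXi s = s * (s - 1) * completedRiemannZeta₀ s + 1 :=
  (tendsto_xiFormula s).limUnder_eq

/-- At the integers `r ≥ 2` the value `ξ(r)` is given by the formula itself. -/
theorem riemannXi_natCast {r : ℕ} (hr : 2 ≤ r) : riemannXi r = xiFormula r := by
  have hr0 : 0 < ((r : ℂ)).re := by simp; omega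
  rw [riemannXi_eq, xiFormula_eq_of_Gammaℝ_ne_zero _ _ (Complex.Gammaℝ_ne_zero_of_re_pos hr0)]
  · exact_mod_cast (by omega : r ≠ 0)
  · exact_mod_cast (by omega : r ≠ 1)

/-! A closed walk of range `R` visits `R` consecutive integers, so it fits strictly between `0` and
`H` in `(H - R)⁺` positions. Counting these placements by the reflection principle gives an exact
identity (`sum_sub_ran`): `∑ (H - R)⁺ + 4 ^ n` is `H` times the number of `2n`-step sequences with
sum divisible by `2H`, and that number is a sum of binomials `(2n).choose (n + jH)`. A wide strip
gives `E R = 4 ^ n / n.centralBinom` (`expectation_ran`); general `H` gives `E (R - H)⁺ = 2H ∑_{j ≥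
1} (2n).choose (n + jH) / n.centralBinom` (`meanExcess_natCast`).

The binomial ratio is `exp (-m² / n)` up to `O(1/n)` with rapid decay in `m / √n`
(`exists_binomRatio_sub_exp_le`). Hence `E (R - t)⁺ = √n G(t / √n) + O(1/√n)`, again with rapid
decay, where `G(y) = 2y ∑_{j ≥ 1} exp (-(jy)²)` (`exists_meanExcess_sub_le`). Between integers the
left side is linear in `t`, so real `t` requires control of the interpolation error of `G`; near `y
= 0` this comes from Jacobi's theta transformation (`limitExcess_eq`).

Finally `x ^ (k+2) = (k+2)(k+1) ∫ y ^ k (x - y)⁺ dy` turns mean excesses into moments. The Mellin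
transform of the theta series `G` is `ζ(k+2) Γ((k+2)/2)`, so the moment of order `k + 2` is
`(k+2)(k+1) ζ(k+2) Γ((k+2)/2) √n ^ (k+2) + O(√n ^ k)`. By Wallis, `E R` is `√(πn) + O(1/√n)`.
Dividing by its power supplies the factor `π ^ (-(k+2)/2)` of `ξ(k+2)`, and both errors are of
relative size `1/n`. -/

namespace SimpleWalk

/-! ### Points of a walk and the interval they fill -/

theorem point_zero {m : ℕ} (w : SimpleWalk m) : w.point 0 = w.start := by simp [point]

theorem point_self {m : ℕ} (a : ℤ) (s : Fin m → ℤˣ) :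
    (mk a s).point m = a + ∑ j, (s j : ℤ) := by simp [point]

theorem point_cons_succ {m : ℕ} (a : ℤ) (u : ℤˣ) (s : Fin m → ℤˣ) (i : ℕ) :
    (mk a (Fin.cons u s : Fin (m + 1) → ℤˣ)).point (i + 1) = (mk (a + u) s).point i := by
  simp [point, Fin.sum_univ_succ, add_assoc]

theorem point_eq_add {m : ℕ} (a : ℤ) (s : Fin m → ℤˣ) (i : ℕ) :
    (mk a s).point i = a + (mk 0 s).point i := by simp [point]

theorem point_succ {m : ℕ} (w : SimpleWalk m) {i : ℕ} (hi : i < m) :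
    w.point (i + 1) = w.point i + w.step ⟨i, hi⟩ := by
  unfold point
  rw [add_assoc]
  congr 1
  have : (w.step ⟨i, hi⟩ : ℤ) = ∑ j : Fin m, if j = ⟨i, hi⟩ then (w.step j : ℤ) else 0 := by simp
  rw [this, ← Finset.sum_add_distrib]
  refine Finset.sum_congr rfl fun j _ => ?_
  rcases lt_trichotomy j.val i with h | h | h
  · rw [if_pos (by omega), if_pos h, if_neg (by intro e; simp [e] at h), add_zero]
  · rw [if_pos (by omega), if_neg (by omega), if_pos (Fin.ext h), zero_add]
  · rw [if_neg (by omega), if_neg (by omega), if_neg (by intro e; simp [e] at h), add_zero]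

/-- The points visited up to any time form an interval. -/
theorem exists_image_point_eq_Icc {m : ℕ} (w : SimpleWalk m) {k : ℕ} (hk : k ≤ m) :
    ∃ lo hi : ℤ, lo ≤ w.point k ∧ w.point k ≤ hi ∧
      (Finset.range (k + 1)).image w.point = Finset.Icc lo hi := by
  induction k with
  | zero => exact ⟨w.point 0, w.point 0, le_rfl, le_rfl, by simp⟩
  | succ k ih =>
    obtain ⟨lo, hi, h1, h2, h3⟩ := ih (by omega)
    have hs := w.point_succ (i := k) (by omega)
    refine ⟨min lo (w.point (k + 1)), max hi (w.point (k + 1)), min_le_right _ _,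
      le_max_right _ _, ?_⟩
    rw [Finset.range_add_one, Finset.image_insert, h3]
    have hu : (w.step ⟨k, by omega⟩ : ℤ) = 1 ∨ (w.step ⟨k, by omega⟩ : ℤ) = -1 := by
      rcases Int.units_eq_one_or (w.step ⟨k, by omega⟩) with h | h <;> simp [h]
    ext q
    simp only [Finset.mem_insert, Finset.mem_Icc]
    omega

end SimpleWalk

open SimpleWalk

/-! ### Step sequences with prescribed sum modulo `N` -/

theorem card_filter_cons (m : ℕ) (P : (Fin (m + 1) → ℤˣ) → Prop) [DecidablePred P] :
    (Finset.univ.filter P).card =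
      (Finset.univ.filter fun s : Fin m → ℤˣ => P (Fin.cons 1 s)).card +
        (Finset.univ.filter fun s : Fin m → ℤˣ => P (Fin.cons (-1) s)).card := by
  simp only [Finset.card_filter]
  rw [← Equiv.sum_comp (Fin.consEquiv fun _ => ℤˣ), Fintype.sum_prod_type, UnitsInt.univ]
  rw [Finset.sum_pair (by decide)]
  rfl

/-- The number of step sequences of length `m` whose sum is `d` modulo `N`. -/
def modCount (N : ℤ) (m : ℕ) (d : ℤ) : ℕ :=
  (Finset.univ.filter fun s : Fin m → ℤˣ => N ∣ (∑ j, (s j : ℤ)) - d).card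

theorem modCount_zero (N d : ℤ) : modCount N 0 d = if N ∣ d then 1 else 0 := by
  simp [modCount, Finset.filter_const]
  split_ifs <;> simp

theorem modCount_succ (N : ℤ) (m : ℕ) (d : ℤ) :
    modCount N (m + 1) d = modCount N m (d - 1) + modCount N m (d + 1) := by
  unfold modCount
  rw [card_filter_cons]
  congr 3 <;> ext s <;> simp only [Fin.sum_univ_succ, Fin.cons_zero, Fin.cons_succ]
  · rw [show ((1 : ℤˣ) : ℤ) + ∑ j, (s j : ℤ) - d = ∑ j, (s j : ℤ) - (d - 1) by push_cast; ring]
  · rw [show ((-1 : ℤˣ) : ℤ) + ∑ j, (s j : ℤ) - d = ∑ j, (s j : ℤ) - (d + 1) by push_cast; ring]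

theorem modCount_congr {N : ℤ} (m : ℕ) {d e : ℤ} (h : N ∣ d - e) :
    modCount N m d = modCount N m e := by
  unfold modCount
  congr 2
  ext s
  rw [← dvd_add_left (a := N) (b := (∑ j, (s j : ℤ)) - d) h]
  ring_nf

/-! ### The reflection principle in a strip -/

/-- All points of the walk with start `a` and steps `s` lie strictly between `0` and `H`. -/
def InStrip {m : ℕ} (H a : ℤ) (s : Fin m → ℤˣ) : Prop :=
  ∀ i ∈ Finset.range (m + 1), 0 < (mk a s).point i ∧ (mk a s).point i < H

noncomputable instance {m : ℕ} (H a : ℤ) (s : Fin m → ℤˣ) : Decidable (InStrip H a s) :=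
  Classical.propDecidable _

/-- The number of walks of length `m` from `a` to `b` which stay strictly between `0` and `H`. -/
noncomputable def stripCount (H : ℤ) (m : ℕ) (a b : ℤ) : ℕ :=
  (Finset.univ.filter fun s : Fin m → ℤˣ => InStrip H a s ∧ (mk a s).point m = b).card

theorem stripCount_of_not_mem {H : ℤ} (m : ℕ) {a : ℤ} (b : ℤ) (ha : ¬(0 < a ∧ a < H)) :
    stripCount H m a b = 0 := by
  unfold stripCount
  rw [Finset.card_eq_zero, Finset.filter_eq_empty_iff]
  intro s _ h
  have := h.1 0 (by simp)
  rw [point_zero] at this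
  exact ha this

theorem stripCount_succ {H : ℤ} (m : ℕ) {a : ℤ} (b : ℤ) (ha : 0 < a ∧ a < H) :
    stripCount H (m + 1) a b = stripCount H m (a + 1) b + stripCount H m (a - 1) b := by
  have key : ∀ (u : ℤˣ) (s : Fin m → ℤˣ),
      (InStrip H a (Fin.cons u s : Fin (m + 1) → ℤˣ) ∧
        (mk a (Fin.cons u s : Fin (m + 1) → ℤˣ)).point (m + 1) = b) ↔
      (InStrip H (a + u) s ∧ (mk (a + u) s).point m = b) := by
    intro u s
    rw [point_cons_succ]
    refine and_congr_left fun _ => ⟨fun h i hi => ?_, fun h i hi => ?_⟩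
    · have := h (i + 1) (by simp at hi ⊢; omega)
      rwa [point_cons_succ] at this
    · rcases i with _ | i
      · rw [point_zero]; exact ha
      · rw [point_cons_succ]
        exact h i (by simp at hi ⊢; omega)
  unfold stripCount
  rw [card_filter_cons]
  congr 3 <;> ext s <;> rw [key] <;> simp [sub_eq_add_neg]

/-- The reflection principle in a strip. -/
theorem stripCount_eq {H : ℤ} (m : ℕ) {a b : ℤ} (ha : 0 ≤ a ∧ a ≤ H) (hb : 0 < b ∧ b < H) :
    (stripCount H m a b : ℤ) = modCount (2 * H) m (b - a) - modCount (2 * H) m (b + a) := by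
  by_cases h : 0 < a ∧ a < H
  · induction m generalizing a with
    | zero =>
      have h1 : ¬ 2 * H ∣ b + a := by
        intro h'
        have := Int.le_of_dvd (by omega) h'
        omega
      have h2 : 2 * H ∣ b - a ↔ a = b := by
        constructor
        · intro h'
          have := Int.eq_zero_of_abs_lt_dvd h' (by rw [abs_lt]; omega)
          omega
        · rintro rfl; simp
      rw [modCount_zero, modCount_zero, if_neg h1]
      simp only [h2]
      have h3 : stripCount H 0 a b = if a = b then 1 else 0 := by
        unfold stripCount
        simp only [InStrip, zero_add, Finset.range_one, Finset.mem_singleton, forall_eq, point_zero, h,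
          and_self, true_and, Finset.filter_const]
        split_ifs <;> simp
      rw [h3]
      simp
    | succ m ih =>
      -- On the walls `c = 0` and `c = H` the two residues coincide modulo `2H`, so the formula
      -- gives `0` there too. Both neighbours of an interior point are thus covered, and both sides
      -- satisfy the same recursion.
      have step : ∀ c : ℤ, 0 ≤ c → c ≤ H → (stripCount H m c b : ℤ) =
          modCount (2 * H) m (b - c) - modCount (2 * H) m (b + c) := by
        intro c h0 hH
        by_cases hc : 0 < c ∧ c < H
        · exact ih ⟨h0, hH⟩ hc
        · rw [stripCount_of_not_mem m b hc, modCount_congr m (d := b - c) (e := b + c), sub_self]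
          · rfl
          · rcases (show c = 0 ∨ c = H by omega) with rfl | rfl
            · simp
            · exact ⟨-1, by ring⟩
      rw [stripCount_succ m b h, modCount_succ, modCount_succ]
      push_cast
      rw [step _ (by omega) (by omega), step _ (by omega) (by omega)]
      ring_nf
  · rw [stripCount_of_not_mem m b h, modCount_congr m (d := b - a) (e := b + a), sub_self]
    · rfl
    · rcases (show a = 0 ∨ a = H by omega) with rfl | rfl
      · simp
      · exact ⟨-1, by ring⟩

/-! ### Double counting of placements in a strip -/

/-- A closed walk of range `ran` fits into a strip with `H - 1` points in `H - ran` ways. -/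
theorem card_strip_positions (n H : ℕ) {s : Fin (2 * n) → ℤˣ} (hs : s ∈ closedSteps n) :
    ((Finset.Ioo (0 : ℤ) H).filter fun a => InStrip H a s).card = H - (mk 0 s).ran := by
  obtain ⟨lo, hi, h1, h2, h3⟩ := (mk 0 s).exists_image_point_eq_Icc (k := 2 * n) le_rfl
  have hcl : (mk 0 s).point (2 * n) = 0 := (mem_closedSteps_iff n 0 s).1 hs
  rw [ran_eq_card _ ((mem_closedSteps_iff n 0 s).1 hs), h3, Int.card_Icc]
  have : ((Finset.Ioo (0 : ℤ) H).filter fun a => InStrip H a s) = Finset.Ioo (-lo) (H - hi) := by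
    ext a
    have e : InStrip H a s ↔ ∀ q ∈ Finset.Icc lo hi, 0 < a + q ∧ a + q < H := by
      rw [← h3, Finset.forall_mem_image, InStrip]
      refine forall₂_congr fun i _ => ?_
      rw [point_eq_add]
    rw [Finset.mem_filter, e, Finset.mem_Ioo, Finset.mem_Ioo]
    constructor
    · rintro ⟨-, h⟩
      have := h lo (by simp; omega)
      have := h hi (by simp; omega)
      omega
    · intro h
      refine ⟨by omega, fun q hq => ?_⟩
      rw [Finset.mem_Icc] at hq
      omega
  -- Both sides truncate at `0`: the interval of positions is empty once the range reaches `H`.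
  rw [this, Int.card_Ioo]
  omega

theorem sum_modCount_even (n : ℕ) {H : ℕ} (hH : 0 < H) :
    ∑ a ∈ Finset.range H, modCount (2 * H) (2 * n) (2 * a) = 4 ^ n := by
  have hev : ∀ s : Fin (2 * n) → ℤˣ, (2 : ℤ) ∣ ∑ j, (s j : ℤ) := by
    intro s
    have : ∑ j, (s j : ℤ) = ∑ j, ((s j : ℤ) - 1) + 2 * n := by
      simp [Finset.sum_sub_distrib]
    rw [this]
    refine dvd_add (Finset.dvd_sum fun j _ => ?_) (dvd_mul_right _ _)
    rcases Int.units_eq_one_or (s j) with h | h <;> simp [h]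
  have hu : ∀ s : Fin (2 * n) → ℤˣ,
      ∑ a ∈ Finset.range H, (if (2 * H : ℤ) ∣ (∑ j, (s j : ℤ)) - 2 * a then 1 else 0) = 1 := by
    intro s
    obtain ⟨q, hq⟩ := hev s
    have hHz : (0 : ℤ) < H := by exact_mod_cast hH
    have h0 := Int.emod_nonneg q hHz.ne'
    have h1 := Int.emod_lt_of_pos q hHz
    -- The sum of the steps is `2q`, so exactly one `a` below `H` qualifies: the residue of `q`.
    rw [Finset.sum_eq_single (q % H).toNat]
    · rw [if_pos]
      rw [hq, Int.toNat_of_nonneg h0, ← mul_sub]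
      exact mul_dvd_mul_left _ (Int.dvd_self_sub_emod)
    · intro a ha hne
      rw [if_neg]
      rw [hq, ← mul_sub, mul_dvd_mul_iff_left two_ne_zero]
      intro h
      apply hne
      have ha' : (a : ℤ) < H := by exact_mod_cast Finset.mem_range.1 ha
      have : q % H = a := by
        rw [(Int.emod_emod_of_dvd q dvd_rfl).symm, Int.emod_emod_of_dvd q dvd_rfl,
          Int.emod_eq_emod_iff_emod_sub_eq_zero.2 (Int.emod_eq_zero_of_dvd h),
          Int.emod_eq_of_lt (by positivity) ha']
      omega
    · intro h
      exfalso
      apply h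
      rw [Finset.mem_range]
      omega
  simp only [modCount, Finset.card_filter]
  rw [Finset.sum_comm, Finset.sum_congr rfl fun s _ => hu s]
  simp [pow_mul]

/-- Pairs (closed walk, admissible starting point) are counted once by walk and once by starting
point, the latter by reflection. The reflected terms run through all even residues modulo `2H` and
so add up to all `4 ^ n` sequences. -/
theorem sum_sub_ran (n : ℕ) {H : ℕ} (hH : 0 < H) :
    (∑ s ∈ closedSteps n, (H - (mk 0 s).ran)) + 4 ^ n = H * modCount (2 * H) (2 * n) 0 := by
  have h1 : ∑ s ∈ closedSteps n, (H - (mk 0 s).ran) =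
      ∑ a ∈ Finset.Ioo (0 : ℤ) H, stripCount H (2 * n) a a := by
    rw [Finset.sum_congr rfl fun s hs => (card_strip_positions n H hs).symm]
    simp only [stripCount, Finset.card_filter]
    rw [Finset.sum_comm]
    refine Finset.sum_congr rfl fun a _ => ?_
    rw [closedSteps, Finset.sum_filter]
    refine Finset.sum_congr rfl fun s _ => ?_
    rw [point_self]
    by_cases h : ∑ j, (s j : ℤ) = 0 <;> simp [h]
  -- Including `a = 0`, where the difference vanishes, completes the system of even residues.
  have h2 : ∑ a ∈ Finset.Ioo (0 : ℤ) H, (stripCount H (2 * n) a a : ℤ) =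
      ∑ a ∈ Finset.range H, ((modCount (2 * H) (2 * n) 0 : ℤ) - modCount (2 * H) (2 * n) (2 * a)) := by
    rw [← Nat.sub_add_cancel hH, Finset.sum_range_succ']
    simp only [Nat.cast_zero, mul_zero, sub_self, add_zero]
    refine Finset.sum_nbij' (fun a => (a - 1).toNat) (fun a => (a : ℤ) + 1) ?_ ?_ ?_ ?_ ?_
    · intro a ha; simp at ha ⊢; omega
    · intro a ha; simp at ha ⊢; omega
    · intro a ha; simp at ha ⊢; omega
    · intro a ha; simp at ha ⊢
    · intro a ha
      have ha' := Finset.mem_Ioo.1 ha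
      rw [stripCount_eq (2 * n) ⟨ha'.1.le, ha'.2.le⟩ ha', sub_self]
      have e : a + a = 2 * (((a - 1).toNat + 1 : ℕ) : ℤ) := by omega
      rw [e]
  have h3 := sum_modCount_even n hH
  rw [Finset.sum_sub_distrib] at h2
  zify at h1 h3 ⊢
  rw [← Nat.cast_sum] at h2
  push_cast at h1 h2 h3 ⊢
  rw [h3] at h2
  rw [h1, h2]
  simp

/-! ### Binomial formulas -/

/-- Here `p` is the number of steps `+1`; splitting off the first step is Pascal's rule. -/
theorem card_steps_sum_eq (m p : ℕ) :
    (Finset.univ.filter fun s : Fin m → ℤˣ => ∑ j, (s j : ℤ) = 2 * p - m).card = m.choose p := by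
  induction m generalizing p with
  | zero => rcases p with _ | p <;> simp [Finset.filter_const]; omega
  | succ m ih =>
    rw [card_filter_cons]
    simp only [Fin.sum_univ_succ, Fin.cons_zero, Fin.cons_succ]
    have h2 : ∀ s : Fin m → ℤˣ, (((-1 : ℤˣ) : ℤ) + ∑ j, (s j : ℤ) = 2 * p - (m + 1 : ℕ)) ↔
        ∑ j, (s j : ℤ) = 2 * p - m := by
      intro s; push_cast; constructor <;> intro h <;> linarith
    simp only [h2, ih p]
    rcases p with _ | p
    · have h1 : (Finset.univ.filter fun s : Fin m → ℤˣ =>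
          ((1 : ℤˣ) : ℤ) + ∑ j, (s j : ℤ) = 2 * (0 : ℕ) - (m + 1 : ℕ)) = ∅ := by
        rw [Finset.filter_eq_empty_iff]
        intro s _ h
        have : ∑ j : Fin m, (-1 : ℤ) ≤ ∑ j, (s j : ℤ) := by
          refine Finset.sum_le_sum fun j _ => ?_
          rcases Int.units_eq_one_or (s j) with h | h <;> simp [h]
        simp at this h
        omega
      rw [h1]
      simp
    · have h1 : ∀ s : Fin m → ℤˣ,
          (((1 : ℤˣ) : ℤ) + ∑ j, (s j : ℤ) = 2 * (p + 1 : ℕ) - (m + 1 : ℕ)) ↔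
          ∑ j, (s j : ℤ) = 2 * p - m := by
        intro s; push_cast; constructor <;> intro h <;> linarith
      simp only [h1, ih p]
      exact (Nat.choose_succ_succ m p).symm

theorem card_steps_sum_eq_two_mul (n k : ℕ) :
    (Finset.univ.filter fun s : Fin (2 * n) → ℤˣ => ∑ j, (s j : ℤ) = 2 * k).card =
      (2 * n).choose (n + k) := by
  rw [← card_steps_sum_eq]
  congr 2
  ext s
  push_cast
  rw [show (2 : ℤ) * (n + k) - 2 * n = 2 * k by ring]

theorem card_steps_sum_eq_neg (n k : ℕ) :
    (Finset.univ.filter fun s : Fin (2 * n) → ℤˣ => ∑ j, (s j : ℤ) = -(2 * k)).card =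
      (2 * n).choose (n + k) := by
  rw [← card_steps_sum_eq_two_mul]
  refine Finset.card_nbij' (fun s => -s) (fun s => -s) ?_ ?_ ?_ ?_
  · intro s hs; simp at hs ⊢; linarith
  · intro s hs; simp at hs ⊢; linarith
  · intro s _; simp
  · intro s _; simp

theorem card_closedSteps (n : ℕ) : (closedSteps n).card = n.centralBinom := by
  have := card_steps_sum_eq_two_mul n 0
  simpa [closedSteps, Nat.centralBinom] using this

/-- A sum divisible by `2H` is `0` or `±2jH` with `j ≥ 1`, and `j ≤ n` because the sum is at most
`2n` in absolute value. The two signs contribute equally. -/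
theorem modCount_zero_eq (n : ℕ) {H : ℕ} (hH : 0 < H) :
    modCount (2 * H) (2 * n) 0 =
      n.centralBinom + 2 * ∑ j ∈ Finset.Icc 1 n, (2 * n).choose (n + j * H) := by
  have key : ∀ s : Fin (2 * n) → ℤˣ,
      (if (2 * H : ℤ) ∣ (∑ j, (s j : ℤ)) - 0 then 1 else 0) =
      (if ∑ j, (s j : ℤ) = 2 * (0 : ℕ) then 1 else 0) + ∑ j ∈ Finset.Icc 1 n,
        ((if ∑ i, (s i : ℤ) = 2 * (j * H : ℕ) then 1 else 0) +
          (if ∑ i, (s i : ℤ) = -(2 * (j * H : ℕ)) then 1 else 0)) := by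
    intro s
    have hb : |∑ j, (s j : ℤ)| ≤ 2 * n := by
      refine (Finset.abs_sum_le_sum_abs _ _).trans ?_
      have : ∀ j ∈ (Finset.univ : Finset (Fin (2 * n))), |(s j : ℤ)| ≤ 1 := by
        intro j _
        rcases Int.units_eq_one_or (s j) with h | h <;> simp [h]
      refine (Finset.sum_le_sum this).trans (by simp)
    generalize (∑ j, (s j : ℤ)) = S at hb ⊢
    have hH' : (0 : ℤ) < H := by exact_mod_cast hH
    rw [sub_zero]
    by_cases hd : (2 * H : ℤ) ∣ S
    · rw [if_pos hd]
      obtain ⟨q, rfl⟩ := hd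
      have hq : |q| ≤ n := by
        rw [abs_mul, abs_of_pos (by positivity)] at hb
        nlinarith [abs_nonneg q]
      have e0 : (2 * (H : ℤ) * q = 2 * (0 : ℕ)) ↔ q = 0 := by
        simp [hH.ne']
      have e1 : ∀ j : ℕ, (2 * (H : ℤ) * q = 2 * (j * H : ℕ)) ↔ q = j := by
        intro j
        push_cast
        rw [show (2 : ℤ) * (j * H) = 2 * H * j by ring, mul_right_inj' (by positivity)]
      have e2 : ∀ j : ℕ, (2 * (H : ℤ) * q = -(2 * (j * H : ℕ))) ↔ q = -j := by
        intro j
        push_cast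
        rw [show -((2 : ℤ) * (j * H)) = 2 * H * (-j) by ring, mul_right_inj' (by positivity)]
      simp only [e0, e1, e2]
      rw [abs_le] at hq
      rcases lt_trichotomy q 0 with h | h | h
      · rw [if_neg h.ne, Finset.sum_eq_single q.natAbs]
        · rw [if_neg (by omega), if_pos (by omega)]
        · intro j hj hne
          rw [Finset.mem_Icc] at hj
          rw [if_neg (by omega), if_neg (by omega), add_zero]
        · intro hne
          rw [Finset.mem_Icc] at hne
          omega
      · rw [if_pos h, Finset.sum_eq_zero, add_zero]
        intro j hj
        rw [Finset.mem_Icc] at hj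
        rw [if_neg (by omega), if_neg (by omega), add_zero]
      · rw [if_neg h.ne', Finset.sum_eq_single q.natAbs]
        · rw [if_pos (by omega), if_neg (by omega)]
        · intro j hj hne
          rw [Finset.mem_Icc] at hj
          rw [if_neg (by omega), if_neg (by omega), add_zero]
        · intro hne
          rw [Finset.mem_Icc] at hne
          omega
    · rw [if_neg hd, if_neg, Finset.sum_eq_zero, add_zero]
      · intro j _
        rw [if_neg, if_neg, add_zero]
        · rintro rfl; exact hd ⟨-j, by push_cast; ring⟩
        · rintro rfl; exact hd ⟨j, by push_cast; ring⟩
      · rintro rfl; simp at hd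
  rw [modCount, Finset.card_filter, Finset.sum_congr rfl fun s _ => key s, Finset.sum_add_distrib,
    Finset.sum_comm, ← Finset.card_filter, card_steps_sum_eq_two_mul, Finset.mul_sum,
    Nat.centralBinom, add_zero]
  congr 1
  refine Finset.sum_congr rfl fun j _ => ?_
  rw [Finset.sum_add_distrib, ← Finset.card_filter, ← Finset.card_filter,
    card_steps_sum_eq_two_mul, card_steps_sum_eq_neg]
  ring

/-! ### Exact mean and mean excess of the range -/

theorem ran_le_of_mem (n : ℕ) {s : Fin (2 * n) → ℤˣ} (hs : s ∈ closedSteps n) :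
    (mk 0 s).ran ≤ 2 * n + 1 := by
  rw [ran_eq_card _ ((mem_closedSteps_iff n 0 s).1 hs)]
  exact Finset.card_image_le.trans (by simp)

theorem one_le_ran (n : ℕ) {s : Fin (2 * n) → ℤˣ} (hs : s ∈ closedSteps n) :
    1 ≤ (mk 0 s).ran := by
  rw [ran_eq_card _ ((mem_closedSteps_iff n 0 s).1 hs), Nat.one_le_iff_ne_zero, Finset.card_ne_zero]
  exact ⟨_, Finset.mem_image_of_mem _ (Finset.mem_range.2 (Nat.succ_pos _))⟩

/-- In the strip identity with `H = 2n + 1` nothing is truncated and all the binomials with `j ≥ 1`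
vanish. -/
theorem sum_ran (n : ℕ) : ∑ s ∈ closedSteps n, (mk 0 s).ran = 4 ^ n := by
  have h := sum_sub_ran n (H := 2 * n + 1) (by omega)
  rw [modCount_zero_eq n (by omega), Finset.sum_eq_zero (s := Finset.Icc 1 n), mul_zero, add_zero,
    ← card_closedSteps] at h
  · have : ∑ s ∈ closedSteps n, (2 * n + 1 - (mk 0 s).ran) + ∑ s ∈ closedSteps n, (mk 0 s).ran =
        (2 * n + 1) * (closedSteps n).card := by
      rw [← Finset.sum_add_distrib, Finset.sum_congr rfl fun s hs =>
        Nat.sub_add_cancel (ran_le_of_mem n hs)]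
      simp [mul_comm]
    omega
  · intro j hj
    rw [Finset.mem_Icc] at hj
    apply Nat.choose_eq_zero_of_lt
    nlinarith

/-- The ratio of the number of walks of length `2n` ending in `2m` to that of the closed ones. -/
noncomputable def binomRatio (n m : ℕ) : ℝ := (2 * n).choose (n + m) / n.centralBinom

theorem expectation_ran (n : ℕ) :
    closedWalkExpectation n (fun w => (w.ran : ℝ)) = 4 ^ n / n.centralBinom := by
  unfold closedWalkExpectation
  rw [card_closedSteps, ← Nat.cast_sum, sum_ran]
  push_cast
  rfl

/-- The mean excess of the range over the level `t`. -/
noncomputable def meanExcess (n : ℕ) (t : ℝ) : ℝ :=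
  closedWalkExpectation n fun w => max ((w.ran : ℝ) - t) 0

/-- Since `(R - H)⁺ = (H - R)⁺ + (R - H)`, the strip identity applies, and its `4 ^ n` cancels
against the total range. -/
theorem meanExcess_natCast (n : ℕ) {H : ℕ} (hH : 0 < H) :
    meanExcess n H = 2 * H * ∑ j ∈ Finset.Icc 1 n, binomRatio n (j * H) := by
  have hC : (n.centralBinom : ℝ) ≠ 0 := by exact_mod_cast n.centralBinom_ne_zero
  unfold meanExcess closedWalkExpectation binomRatio
  rw [card_closedSteps, ← Finset.sum_div, mul_div_assoc']
  congr 1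
  have h := sum_sub_ran n hH
  rw [modCount_zero_eq n hH] at h
  have h4 := sum_ran n
  have hc := card_closedSteps n
  have e : ∑ s ∈ closedSteps n, max (((mk 0 s).ran : ℝ) - H) 0 =
      ∑ s ∈ closedSteps n, (((H - (mk 0 s).ran : ℕ) : ℝ) + (((mk 0 s).ran : ℝ) - H)) := by
    refine Finset.sum_congr rfl fun s _ => ?_
    rcases le_total H (mk 0 s).ran with hle | hle
    · rw [max_eq_left (by simpa using hle), Nat.sub_eq_zero_of_le hle]; simp
    · rw [max_eq_right (by simpa using hle), Nat.cast_sub hle]; ring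
  rw [e, Finset.sum_add_distrib, Finset.sum_sub_distrib, Finset.sum_const, nsmul_eq_mul, hc]
  have h' : (∑ s ∈ closedSteps n, ((H - (mk 0 s).ran : ℕ) : ℝ)) + 4 ^ n =
      H * (n.centralBinom + 2 * ∑ j ∈ Finset.Icc 1 n, ((2 * n).choose (n + j * H) : ℝ)) := by
    exact_mod_cast h
  have h4' : ∑ s ∈ closedSteps n, ((mk 0 s).ran : ℝ) = 4 ^ n := by exact_mod_cast h4
  rw [h4']
  linear_combination h'

/-! ### The local limit theorem -/

/-- One term of the series of `exp (c(1 + y))` dominates the power, and `1 + y - y² ≤ 2`. -/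
theorem exists_one_add_pow_mul_exp_neg_le {c : ℝ} (hc : 0 < c) (M : ℕ) :
    ∃ C : ℝ, 0 < C ∧ ∀ y : ℝ, 0 ≤ y → (1 + y) ^ M * Real.exp (-(c * y ^ 2)) ≤ C := by
  refine ⟨M.factorial / c ^ M * Real.exp (2 * c), by positivity, fun y hy => ?_⟩
  have h1 := Real.pow_div_factorial_le_exp (c * (1 + y)) (by positivity) M
  rw [div_le_iff₀ (by positivity), mul_pow] at h1
  have h2 : (1 + y) ^ M ≤ M.factorial / c ^ M * Real.exp (c * (1 + y)) := by
    rw [div_mul_eq_mul_div, le_div_iff₀ (by positivity)]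
    linarith
  calc (1 + y) ^ M * Real.exp (-(c * y ^ 2))
      ≤ M.factorial / c ^ M * Real.exp (c * (1 + y)) * Real.exp (-(c * y ^ 2)) := by gcongr
    _ = M.factorial / c ^ M * Real.exp (c * (1 + y) - c * y ^ 2) := by
        rw [mul_assoc, ← Real.exp_add]; ring_nf
    _ ≤ _ := by
        gcongr
        nlinarith [sq_nonneg (y - 1 / 2)]

/-- Both functions expand as `1 - 2s + 2s² + O(s³)`. For `s ≥ 1/2` both lie in `[0, 1]` and `8s³ ≥
1`. -/
theorem abs_div_sub_exp_le {s : ℝ} (h0 : 0 ≤ s) (h1 : s ≤ 1) :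
    |(1 - s) / (1 + s) - Real.exp (-(2 * s))| ≤ 8 * s ^ 3 := by
  rcases le_total s (1 / 2) with h | h
  · have hb := Real.exp_bound (x := -(2 * s)) (by rw [abs_neg, abs_of_nonneg] <;> linarith)
      (n := 3) (by norm_num)
    rw [abs_neg, abs_of_nonneg (by linarith : 0 ≤ 2 * s)] at hb
    norm_num [Finset.sum_range_succ, Nat.factorial] at hb
    have e : (1 - s) / (1 + s) = 1 - 2 * s + 2 * s ^ 2 - 2 * s ^ 3 / (1 + s) := by
      field_simp; ring
    have h3 : 2 * s ^ 3 / (1 + s) ≤ 2 * s ^ 3 := div_le_self (by positivity) (by linarith)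
    have h4 : 0 ≤ 2 * s ^ 3 / (1 + s) := by positivity
    have h5 : 0 ≤ s ^ 3 := by positivity
    rw [e, abs_le]
    rw [abs_le] at hb
    constructor <;> nlinarith [hb.1, hb.2]
  · have h3 : (1 : ℝ) ≤ 8 * s ^ 3 := by
      have : (1 / 2 : ℝ) ^ 3 ≤ s ^ 3 := by gcongr
      linarith
    have h4 : 0 ≤ (1 - s) / (1 + s) := div_nonneg (by linarith) (by linarith)
    have h5 : (1 - s) / (1 + s) ≤ 1 := by rw [div_le_one (by linarith)]; linarith
    have h6 := Real.exp_pos (-(2 * s))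
    have h7 : Real.exp (-(2 * s)) ≤ 1 := Real.exp_le_one_iff.2 (by linarith)
    rw [abs_le]; constructor <;> linarith

/-- With `s = (2m+1)/(2n+1)` the ratio of consecutive binomials is exactly `(1 - s)/(1 + s)`;
replacing `2s` by `(2m+1)/n` costs at most `(m+1)/n²`. -/
theorem abs_ratio_sub_exp_le {n m : ℕ} (hn : 0 < n) (hm : m ≤ n) :
    |((n : ℝ) - m) / (n + m + 1) - Real.exp (-((2 * m + 1) / n))| ≤
      8 * ((m + 1) / n ^ 2 + ((m + 1) / n) ^ 3) := by
  have hn' : (0 : ℝ) < n := by exact_mod_cast hn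
  have hm' : (m : ℝ) ≤ n := by exact_mod_cast hm
  set s : ℝ := (2 * m + 1) / (2 * n + 1) with hs
  have hs0 : 0 ≤ s := by positivity
  have hs1 : s ≤ 1 := by rw [hs, div_le_one (by positivity)]; linarith
  have e : ((n : ℝ) - m) / (n + m + 1) = (1 - s) / (1 + s) := by
    rw [hs]; field_simp; ring
  have hst : s ≤ (m + 1) / n := by
    rw [hs, div_le_div_iff₀ (by positivity) hn']; nlinarith
  have h1 := abs_div_sub_exp_le hs0 hs1
  have h2 : s ^ 3 ≤ ((m + 1) / n) ^ 3 := by gcongr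
  have h3 : |Real.exp (-(2 * s)) - Real.exp (-((2 * m + 1) / n))| ≤ (m + 1) / n ^ 2 := by
    have e2 : (2 * m + 1) / n - 2 * s = (2 * m + 1) / (n * (2 * n + 1)) := by
      rw [hs]; field_simp; ring
    have e3 : Real.exp (-((2 * m + 1) / n)) =
        Real.exp (-(2 * s)) * Real.exp (-((2 * m + 1) / (n * (2 * n + 1)))) := by
      rw [← Real.exp_add, ← e2]; ring_nf
    have h5 := Real.add_one_le_exp (-((2 * (m : ℝ) + 1) / (n * (2 * n + 1))))
    have h6 : (2 * (m : ℝ) + 1) / (n * (2 * n + 1)) ≤ (m + 1) / n ^ 2 := by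
      rw [div_le_div_iff₀ (by positivity) (by positivity)]
      nlinarith [mul_pos hn' hn']
    have h7 : Real.exp (-(2 * s)) ≤ 1 := Real.exp_le_one_iff.2 (by linarith)
    have h8 := Real.exp_pos (-(2 * s))
    have h9 : Real.exp (-((2 * (m : ℝ) + 1) / (n * (2 * n + 1)))) ≤ 1 :=
      Real.exp_le_one_iff.2 (neg_nonpos.2 (by positivity))
    rw [e3, abs_of_nonneg (by nlinarith)]
    nlinarith
  have h4 : (0 : ℝ) ≤ (m + 1) / n ^ 2 := by positivity
  rw [e]
  refine (abs_sub_le _ (Real.exp (-(2 * s))) _).trans ?_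
  linarith

theorem binomRatio_zero (n : ℕ) : binomRatio n 0 = 1 := by
  have hC : (n.centralBinom : ℝ) ≠ 0 := by exact_mod_cast n.centralBinom_ne_zero
  simp [binomRatio, ← Nat.centralBinom_eq_two_mul_choose, hC]

theorem binomRatio_succ {n m : ℕ} (hm : m ≤ n) :
    binomRatio n (m + 1) = binomRatio n m * (((n : ℝ) - m) / (n + m + 1)) := by
  have h := Nat.choose_succ_right_eq (2 * n) (n + m)
  have h' : ((2 * n).choose (n + m + 1) : ℝ) * (n + m + 1) = (2 * n).choose (n + m) * (n - m) := by
    have e : ((2 * n - (n + m) : ℕ) : ℝ) = n - m := by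
      rw [show 2 * n - (n + m) = n - m by omega, Nat.cast_sub hm]
    rw [← e]
    exact_mod_cast h
  unfold binomRatio
  rw [← add_assoc, mul_div_assoc', div_mul_eq_mul_div, ← h', div_right_comm, mul_div_assoc,
    div_self (by positivity), mul_one]

theorem binomRatio_of_lt {n m : ℕ} (hm : n < m) : binomRatio n m = 0 := by
  rw [binomRatio, Nat.choose_eq_zero_of_lt (by omega)]; simp

/-- Both quantities are products over `i < m`, compared one factor at a time. The weaker exponent
`m²/(3n)` is a decay rate that both products satisfy; the factor `exp 1` pays for passing from `m`
to `m + 1`. -/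
theorem binomRatio_sub_exp_le_sum {n m : ℕ} (hn : 0 < n) (hm : m ≤ n) :
    |binomRatio n m - Real.exp (-((m : ℝ) ^ 2 / n))| ≤
      Real.exp (-((m : ℝ) ^ 2 / (3 * n))) * ∑ i ∈ Finset.range m,
        8 * Real.exp 1 * (((i : ℝ) + 1) / n ^ 2 + ((i + 1) / n) ^ 3) := by
  have hn' : (0 : ℝ) < n := by exact_mod_cast hn
  have hn1 : (1 : ℝ) ≤ n := by exact_mod_cast hn
  induction m with
  | zero => simp [binomRatio_zero]
  | succ m ih =>
    have ih := ih (by omega)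
    have hm' : (m : ℝ) + 1 ≤ n := by exact_mod_cast hm
    have hab := abs_ratio_sub_exp_le hn (show m ≤ n by omega)
    rw [binomRatio_succ (by omega), Finset.sum_range_succ, mul_add]
    set p := binomRatio n m
    set q := Real.exp (-((m : ℝ) ^ 2 / n))
    set a := ((n : ℝ) - m) / (n + m + 1)
    set b := Real.exp (-((2 * (m : ℝ) + 1) / n))
    set S := ∑ i ∈ Finset.range m, 8 * Real.exp 1 * (((i : ℝ) + 1) / n ^ 2 + ((i + 1) / n) ^ 3)
    set ε := ((m : ℝ) + 1) / n ^ 2 + ((m + 1) / n) ^ 3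
    have hε : 0 ≤ ε := by positivity
    have hS : 0 ≤ S := Finset.sum_nonneg fun i _ => by positivity
    have hq : Real.exp (-(((m + 1 : ℕ) : ℝ) ^ 2 / n)) = q * b := by
      rw [← Real.exp_add]
      congr 1
      push_cast
      field_simp
      ring
    have ha0 : 0 ≤ a := div_nonneg (by linarith) (by positivity)
    have ha : a ≤ Real.exp (-((2 * (m : ℝ) + 1) / (3 * n))) := by
      have e : a = -((2 * (m : ℝ) + 1) / (n + m + 1)) + 1 := by
        simp only [a]; field_simp; ring
      rw [e]
      refine (Real.add_one_le_exp _).trans ?_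
      gcongr
      linarith
    have hq2 : q ≤ Real.exp 1 * Real.exp (-(((m + 1 : ℕ) : ℝ) ^ 2 / (3 * n))) := by
      rw [← Real.exp_add]
      refine Real.exp_le_exp.2 ?_
      rw [neg_le_iff_add_nonneg]
      have : 1 + -(((m + 1 : ℕ) : ℝ) ^ 2 / (3 * n)) + (m : ℝ) ^ 2 / n =
          (3 * n + 3 * (m : ℝ) ^ 2 - (m + 1) ^ 2) / (3 * n) := by
        push_cast; field_simp; ring
      rw [this]
      apply div_nonneg _ (by positivity)
      nlinarith [sq_nonneg ((m : ℝ) - 1)]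
    have hexp : Real.exp (-((m : ℝ) ^ 2 / (3 * n))) * Real.exp (-((2 * (m : ℝ) + 1) / (3 * n))) =
        Real.exp (-(((m + 1 : ℕ) : ℝ) ^ 2 / (3 * n))) := by
      rw [← Real.exp_add]
      congr 1
      push_cast
      field_simp
      ring
    rw [hq, show p * a - q * b = (p - q) * a + q * (a - b) by ring]
    refine (abs_add_le _ _).trans (add_le_add ?_ ?_)
    · rw [abs_mul, abs_of_nonneg ha0, ← hexp, mul_right_comm]
      gcongr
    · rw [abs_mul, abs_of_pos (Real.exp_pos _)]
      calc q * |a - b| ≤ (Real.exp 1 * Real.exp (-(((m + 1 : ℕ) : ℝ) ^ 2 / (3 * n)))) * (8 * ε) := by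
            gcongr
        _ = _ := by ring

/-- A local limit theorem with rate of convergence. -/
theorem exists_binomRatio_sub_exp_le (M : ℕ) :
    ∃ C : ℝ, 0 < C ∧ ∀ n m : ℕ, 0 < n →
      |binomRatio n m - Real.exp (-((m / √n) ^ 2))| ≤ C / n * ((1 + m / √n) ^ M)⁻¹ := by
  -- The rate `1/3` is that of the product estimate. The four extra powers absorb `y² + y⁴`, `y =
  -- m/√n`, which arises from `m` error terms of size `m/n² + (m/n)³`.
  obtain ⟨C, hC, h⟩ := exists_one_add_pow_mul_exp_neg_le (c := 1 / 3) (by norm_num) (M + 4)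
  refine ⟨16 * Real.exp 1 * C, by positivity, fun n m hn => ?_⟩
  have hn' : (0 : ℝ) < n := by exact_mod_cast hn
  have hy0 : (0 : ℝ) ≤ m / √n := by positivity
  have hysq : (m / √n) ^ 2 = (m : ℝ) ^ 2 / n := by rw [div_pow, Real.sq_sqrt hn'.le]
  have main : |binomRatio n m - Real.exp (-((m / √n) ^ 2))| ≤
      8 * Real.exp 1 / n * ((m / √n) ^ 2 + (m / √n) ^ 4) *
        Real.exp (-(1 / 3 * (m / √n) ^ 2)) := by
    have e3 : (m : ℝ) ^ 2 / (3 * n) = 1 / 3 * (m / √n) ^ 2 := by rw [hysq]; field_simp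
    rcases le_or_gt m n with hm | hm
    · have h1 := binomRatio_sub_exp_le_sum hn hm
      rw [← hysq, e3] at h1
      refine h1.trans ?_
      rw [mul_comm (Real.exp _)]
      gcongr
      have : ∀ i ∈ Finset.range m, 8 * Real.exp 1 * (((i : ℝ) + 1) / n ^ 2 + ((i + 1) / n) ^ 3) ≤
          8 * Real.exp 1 * ((m : ℝ) / n ^ 2 + (m / n) ^ 3) := by
        intro i hi
        have : (i : ℝ) + 1 ≤ m := by exact_mod_cast Finset.mem_range.1 hi
        gcongr
      refine (Finset.sum_le_sum this).trans (le_of_eq ?_)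
      rw [Finset.sum_const, Finset.card_range, nsmul_eq_mul,
        show (m / √n) ^ 4 = ((m / √n) ^ 2) ^ 2 by ring, hysq]
      field_simp
    -- For `m > n` the ratio is `0`, and the prefactor of the bound is at least `1` since `m² ≥ n²`.
    · rw [binomRatio_of_lt hm, zero_sub, abs_neg, abs_of_pos (Real.exp_pos _)]
      have h1 : 1 ≤ 8 * Real.exp 1 / n * ((m / √n) ^ 2 + (m / √n) ^ 4) := by
        have h2 : (1 : ℝ) ≤ (m / √n) ^ 2 / n := by
          rw [hysq, div_div, one_le_div (by positivity)]
          have : (n : ℝ) ≤ m := by exact_mod_cast hm.le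
          nlinarith
        have h3 : (0 : ℝ) ≤ (m / √n) ^ 4 / n := by positivity
        have h4 : 1 ≤ Real.exp 1 := Real.one_le_exp (by norm_num)
        rw [div_mul_eq_mul_div, mul_div_assoc, add_div]
        nlinarith
      have h2 : Real.exp (-(m / √n) ^ 2) ≤ Real.exp (-(1 / 3 * (m / √n) ^ 2)) :=
        Real.exp_le_exp.2 (by nlinarith [sq_nonneg (m / √n)])
      calc _ ≤ 1 * Real.exp (-(1 / 3 * (m / √n) ^ 2)) := by rwa [one_mul]
        _ ≤ _ := by gcongr
  generalize (m : ℝ) / √n = y at *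
  have hp : y ^ 2 + y ^ 4 ≤ 2 * (1 + y) ^ 4 := by
    have h1 : y ^ 4 ≤ (1 + y) ^ 4 := by gcongr; linarith
    have h2 : y ^ 2 ≤ (1 + y) ^ 4 := by nlinarith [pow_nonneg hy0 3, pow_nonneg hy0 4]
    linarith
  refine main.trans ?_
  rw [← div_eq_mul_inv, le_div_iff₀ (by positivity)]
  calc 8 * Real.exp 1 / n * (y ^ 2 + y ^ 4) * Real.exp (-(1 / 3 * y ^ 2)) * (1 + y) ^ M
      ≤ 8 * Real.exp 1 / n * (2 * (1 + y) ^ 4) * Real.exp (-(1 / 3 * y ^ 2)) * (1 + y) ^ M := by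
        gcongr
    _ = 16 * Real.exp 1 / n * ((1 + y) ^ (M + 4) * Real.exp (-(1 / 3 * y ^ 2))) := by ring
    _ ≤ 16 * Real.exp 1 / n * C := by gcongr; exact h y hy0
    _ = _ := by ring

/-! ### Errors of linear interpolation -/

/-- Both `B x²/2 + f` and `B x²/2 - f` are convex, which bounds the error by `(B/2) θ(1 - θ) δ²`. -/
theorem abs_interpolation_sub_le {f f' f'' : ℝ → ℝ} {u δ B : ℝ} (hδ : 0 ≤ δ)
    (hf : ∀ x ∈ Set.Icc u (u + δ), HasDerivAt f (f' x) x)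
    (hf' : ∀ x ∈ Set.Icc u (u + δ), HasDerivAt f' (f'' x) x)
    (hB : ∀ x ∈ Set.Icc u (u + δ), |f'' x| ≤ B) {θ : ℝ} (h0 : 0 ≤ θ) (h1 : θ ≤ 1) :
    |(1 - θ) * f u + θ * f (u + δ) - f (u + θ * δ)| ≤ B * δ ^ 2 := by
  have hu : u ∈ Set.Icc u (u + δ) := ⟨le_rfl, by linarith⟩
  have hv : u + δ ∈ Set.Icc u (u + δ) := ⟨by linarith, le_rfl⟩
  have hB0 : 0 ≤ B := (abs_nonneg _).trans (hB u hu)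
  have hq : ∀ x, HasDerivAt (fun x : ℝ => B / 2 * x ^ 2) (B * x) x := fun x => by
    exact ((hasDerivAt_pow 2 x).const_mul (B / 2)).congr_deriv (by push_cast; ring)
  have hq' : ∀ x, HasDerivAt (fun x : ℝ => B * x) B x := fun x => by
    simpa using (hasDerivAt_id x).const_mul B
  have sub : interior (Set.Icc u (u + δ)) ⊆ Set.Icc u (u + δ) := interior_subset
  have key : ∀ σ : ℝ, |σ| = 1 →
      ConvexOn ℝ (Set.Icc u (u + δ)) (fun x => B / 2 * x ^ 2 + σ * f x) := by
    intro σ hσ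
    refine convexOn_of_hasDerivWithinAt2_nonneg (f' := fun x => B * x + σ * f' x)
      (f'' := fun x => B + σ * f'' x) (convex_Icc _ _) ?_ ?_ ?_ ?_
    · exact fun x hx => ((hq x).add ((hf x hx).const_mul σ)).continuousAt.continuousWithinAt
    · exact fun x hx => ((hq x).add ((hf x (sub hx)).const_mul σ)).hasDerivWithinAt
    · exact fun x hx => ((hq' x).add ((hf' x (sub hx)).const_mul σ)).hasDerivWithinAt
    · intro x hx
      have h2 : |σ * f'' x| ≤ B := by rw [abs_mul, hσ, one_mul]; exact hB x (sub hx)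
      linarith [(abs_le.1 h2).1]
  have hpt : (1 - θ) * u + θ * (u + δ) = u + θ * δ := by ring
  have hp := (key 1 (by simp)).2 hu hv (sub_nonneg.2 h1) h0 (by ring)
  have hm := (key (-1) (by simp)).2 hu hv (sub_nonneg.2 h1) h0 (by ring)
  simp only [smul_eq_mul, hpt] at hp hm
  have hθ : 0 ≤ θ * (1 - θ) := mul_nonneg h0 (by linarith)
  have hθ' : θ * (1 - θ) ≤ 1 := by nlinarith
  have hBd : 0 ≤ B * δ ^ 2 := by positivity
  have e : B / 2 * θ * (1 - θ) * δ ^ 2 ≤ B * δ ^ 2 := by nlinarith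
  rw [abs_le]
  constructor <;> nlinarith

/-- `u ↦ 2 u exp (-u²)` is well approximated by linear interpolation. -/
theorem exists_interpolation_gaussian_le (M : ℕ) :
    ∃ C : ℝ, 0 < C ∧ ∀ u δ θ : ℝ, 0 ≤ u → 0 ≤ δ → 0 ≤ θ → θ ≤ 1 →
      |(1 - θ) * (2 * u * Real.exp (-u ^ 2)) + θ * (2 * (u + δ) * Real.exp (-(u + δ) ^ 2)) -
        2 * (u + θ * δ) * Real.exp (-(u + θ * δ) ^ 2)| ≤ C * ((1 + u) ^ M)⁻¹ * δ ^ 2 := by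
  -- Three extra powers for the cubic factor of the second derivative.
  obtain ⟨C, hC, h⟩ := exists_one_add_pow_mul_exp_neg_le one_pos (M + 3)
  refine ⟨20 * C, by positivity, fun u δ θ hu hδ h0 h1 => ?_⟩
  have hE : ∀ x : ℝ, HasDerivAt (fun x : ℝ => Real.exp (-x ^ 2)) (-(2 * x) * Real.exp (-x ^ 2)) x := by
    intro x
    exact ((hasDerivAt_pow 2 x).fun_neg.exp).congr_deriv (by push_cast; ring)
  refine abs_interpolation_sub_le (f := fun u => 2 * u * Real.exp (-u ^ 2))
    (f' := fun x => (2 - 4 * x ^ 2) * Real.exp (-x ^ 2))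
    (f'' := fun x => (8 * x ^ 3 - 12 * x) * Real.exp (-x ^ 2)) hδ ?_ ?_ ?_ h0 h1
  · intro x _
    exact (((hasDerivAt_id' x).const_mul 2).fun_mul (hE x)).congr_deriv (by ring)
  · intro x _
    exact ((((hasDerivAt_pow 2 x).const_mul 4).const_sub 2).fun_mul (hE x)).congr_deriv
      (by push_cast; ring)
  · intro x hx
    have hx0 : 0 ≤ x := hu.trans hx.1
    have h2 := h x hx0
    rw [one_mul] at h2
    have h3 : |8 * x ^ 3 - 12 * x| ≤ 20 * (1 + x) ^ 3 := by
      rw [abs_le]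
      constructor <;> nlinarith [pow_nonneg hx0 3, pow_nonneg hx0 2]
    have h4 : (1 + u) ^ M ≤ (1 + x) ^ M := by gcongr; exact hx.1
    rw [abs_mul, abs_of_pos (Real.exp_pos _), ← div_eq_mul_inv, le_div_iff₀ (by positivity)]
    calc |8 * x ^ 3 - 12 * x| * Real.exp (-x ^ 2) * (1 + u) ^ M
        ≤ (20 * (1 + x) ^ 3) * Real.exp (-x ^ 2) * (1 + x) ^ M := by gcongr
      _ = 20 * ((1 + x) ^ (M + 3) * Real.exp (-x ^ 2)) := by ring
      _ ≤ 20 * C := by gcongr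

/-- `x ↦ exp (-1/x²)` is well approximated by linear interpolation. -/
theorem exists_interpolation_exp_inv_sq_le :
    ∃ C : ℝ, 0 < C ∧ ∀ u δ θ : ℝ, 0 < u → 0 ≤ δ → 0 ≤ θ → θ ≤ 1 →
      |(1 - θ) * Real.exp (-u⁻¹ ^ 2) + θ * Real.exp (-(u + δ)⁻¹ ^ 2) -
        Real.exp (-(u + θ * δ)⁻¹ ^ 2)| ≤ C * δ ^ 2 := by
  -- The second derivative is a polynomial of degree `6` in `1/x` times `exp (-1/x²)`, hence bounded
  -- up to `x = 0`.
  obtain ⟨C, hC, h⟩ := exists_one_add_pow_mul_exp_neg_le one_pos 6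
  refine ⟨10 * C, by positivity, fun u δ θ hu hδ h0 h1 => ?_⟩
  have hE : ∀ x : ℝ, 0 < x → HasDerivAt (fun x : ℝ => Real.exp (-x⁻¹ ^ 2))
      (2 * x⁻¹ ^ 3 * Real.exp (-x⁻¹ ^ 2)) x := by
    intro x hx
    refine (((hasDerivAt_inv hx.ne').fun_pow 2).fun_neg.exp).congr_deriv ?_
    push_cast
    rw [← inv_pow]
    ring
  refine abs_interpolation_sub_le (f := fun u => Real.exp (-u⁻¹ ^ 2))
    (f' := fun x => 2 * x⁻¹ ^ 3 * Real.exp (-x⁻¹ ^ 2))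
    (f'' := fun x => (4 * x⁻¹ ^ 6 - 6 * x⁻¹ ^ 4) * Real.exp (-x⁻¹ ^ 2)) hδ ?_ ?_ ?_ h0 h1
  · exact fun x hx => hE x (hu.trans_le hx.1)
  · intro x hx
    have hx0 : 0 < x := hu.trans_le hx.1
    refine ((((hasDerivAt_inv hx0.ne').fun_pow 3).const_mul 2).fun_mul (hE x hx0)).congr_deriv ?_
    push_cast
    rw [← inv_pow]
    ring
  · intro x hx
    have hx0 : 0 < x⁻¹ := inv_pos.2 (hu.trans_le hx.1)
    have h2 := h x⁻¹ hx0.le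
    rw [one_mul] at h2
    generalize x⁻¹ = v at *
    have h3 : |4 * v ^ 6 - 6 * v ^ 4| ≤ 10 * (1 + v) ^ 6 := by
      have h4 : v ^ 6 ≤ (1 + v) ^ 6 := by gcongr; linarith
      have h5 : v ^ 4 ≤ (1 + v) ^ 6 := by
        calc v ^ 4 ≤ (1 + v) ^ 4 := by gcongr; linarith
          _ ≤ (1 + v) ^ 6 := pow_le_pow_right₀ (by linarith) (by norm_num)
      have h6 : 0 ≤ v ^ 6 := by positivity
      have h7 : 0 ≤ v ^ 4 := by positivity
      rw [abs_le]
      constructor <;> linarith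
    rw [abs_mul, abs_of_pos (Real.exp_pos _)]
    calc |4 * v ^ 6 - 6 * v ^ 4| * Real.exp (-v ^ 2)
        ≤ (10 * (1 + v) ^ 6) * Real.exp (-v ^ 2) := by gcongr
      _ = 10 * ((1 + v) ^ 6 * Real.exp (-v ^ 2)) := by ring
      _ ≤ 10 * C := by gcongr

/-! ### The limit function and its theta transformation -/

/-- The scaling limit of the mean excess of the range. -/
noncomputable def limitExcess (y : ℝ) : ℝ :=
  2 * y * ∑' j : ℕ, Real.exp (-(((j : ℝ) + 1) * y) ^ 2)

theorem summable_inv_succ_sq : Summable fun j : ℕ => (((j : ℝ) + 1) ^ 2)⁻¹ := by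
  have := (summable_nat_add_iff 1).2 (Real.summable_nat_pow_inv (p := 2).2 (by norm_num))
  simpa using this

theorem exp_neg_sq_le_inv {x : ℝ} (hx : 0 < x) : Real.exp (-x ^ 2) ≤ (x ^ 2)⁻¹ := by
  rw [Real.exp_neg]
  apply inv_anti₀ (by positivity)
  linarith [Real.add_one_le_exp (x ^ 2)]

theorem summable_exp_neg_sq {y : ℝ} (hy : 0 < y) :
    Summable fun j : ℕ => Real.exp (-(((j : ℝ) + 1) * y) ^ 2) := by
  refine Summable.of_nonneg_of_le (fun j => (Real.exp_pos _).le)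
    (fun j => exp_neg_sq_le_inv (by positivity)) ?_
  simp_rw [mul_pow, mul_inv]
  exact summable_inv_succ_sq.mul_right _

theorem tsum_int_exp_neg_sq {y : ℝ} (hy : 0 < y) :
    ∑' j : ℤ, Real.exp (-((j : ℝ) * y) ^ 2) =
      1 + 2 * ∑' j : ℕ, Real.exp (-(((j : ℝ) + 1) * y) ^ 2) := by
  have h := (summable_exp_neg_sq hy).hasSum
  have h2 : HasSum (fun j : ℤ => Real.exp (-((j : ℝ) * y) ^ 2))
      ((∑' j : ℕ, Real.exp (-(((j : ℝ) + 1) * y) ^ 2)) + Real.exp (-((0 : ℤ) * y) ^ 2) +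
        ∑' j : ℕ, Real.exp (-(((j : ℝ) + 1) * y) ^ 2)) := by
    refine HasSum.of_add_one_of_neg_add_one ?_ ?_
    · simpa using h
    · convert h using 3 with j
      push_cast
      ring
  rw [h2.tsum_eq]
  simp
  ring

/-- Jacobi's theta transformation. -/
theorem limitExcess_eq {y : ℝ} (hy : 0 < y) :
    limitExcess y = √Real.pi - y +
      2 * √Real.pi * ∑' k : ℕ, Real.exp (-(((k : ℝ) + 1) * (Real.pi / y)) ^ 2) := by
  have hpi := Real.pi_pos
  -- The parameter `y²/π` turns the two exponents into `-(jy)²` and `-(jπ/y)²`.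
  have h := Real.tsum_exp_neg_mul_int_sq (a := y ^ 2 / Real.pi) (by positivity)
  have e1 : ∀ j : ℤ, -Real.pi * (y ^ 2 / Real.pi) * (j : ℝ) ^ 2 = -((j : ℝ) * y) ^ 2 := by
    intro j; field_simp
  have e2 : ∀ j : ℤ, -Real.pi / (y ^ 2 / Real.pi) * (j : ℝ) ^ 2 =
      -((j : ℝ) * (Real.pi / y)) ^ 2 := by
    intro j; field_simp
  simp only [e1, e2] at h
  rw [tsum_int_exp_neg_sq hy, tsum_int_exp_neg_sq (by positivity), ← Real.sqrt_eq_rpow,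
    Real.sqrt_div (by positivity), Real.sqrt_sq hy.le, one_div_div] at h
  unfold limitExcess
  have h' : y * (1 + 2 * ∑' j : ℕ, Real.exp (-(((j : ℝ) + 1) * y) ^ 2)) =
      √Real.pi * (1 + 2 * ∑' k : ℕ, Real.exp (-(((k : ℝ) + 1) * (Real.pi / y)) ^ 2)) := by
    rw [h, ← mul_assoc, mul_div_cancel₀ _ hy.ne']
  linarith

/-- In the transformed series the remainder is tiny near `0`; the crude bound `exp (-x²) ≤ x⁻²`
already gives `O(y²)`. -/
theorem exists_limitExcess_sub_le :
    ∃ C : ℝ, 0 < C ∧ ∀ y : ℝ, 0 < y → |limitExcess y - (√Real.pi - y)| ≤ C * y ^ 2 := by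
  have hpi := Real.pi_pos
  refine ⟨2 * √Real.pi * (∑' k : ℕ, (((k : ℝ) + 1) ^ 2)⁻¹) * (Real.pi ^ 2)⁻¹, ?_, fun y hy => ?_⟩
  · have := summable_inv_succ_sq.tsum_pos (fun j => by positivity) 0 (by norm_num)
    positivity
  · have h1 : ∑' k : ℕ, Real.exp (-(((k : ℝ) + 1) * (Real.pi / y)) ^ 2) ≤
        ∑' k : ℕ, (((k : ℝ) + 1) ^ 2)⁻¹ * ((Real.pi ^ 2)⁻¹ * y ^ 2) := by
      refine (summable_exp_neg_sq (by positivity)).tsum_le_tsum (fun k => ?_)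
        (summable_inv_succ_sq.mul_right _)
      refine (exp_neg_sq_le_inv (by positivity)).trans (le_of_eq ?_)
      field_simp
    rw [tsum_mul_right] at h1
    have h0 : 0 ≤ ∑' k : ℕ, Real.exp (-(((k : ℝ) + 1) * (Real.pi / y)) ^ 2) :=
      tsum_nonneg fun k => (Real.exp_pos _).le
    rw [limitExcess_eq hy, add_sub_cancel_left, abs_of_nonneg (by positivity)]
    calc _ ≤ 2 * √Real.pi * ((∑' k : ℕ, (((k : ℝ) + 1) ^ 2)⁻¹) * ((Real.pi ^ 2)⁻¹ * y ^ 2)) := by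
          gcongr
      _ = _ := by ring

/-- The term of index `c = j + 1` is a rescaling of `2u exp (-u²)`. As `y ≥ 1`, three of the `M + 3`
powers give `c⁻³`, which leaves the summable `c⁻²` after rescaling. -/
theorem exists_interpolation_limitExcess_le_of_one_le (M : ℕ) :
    ∃ C : ℝ, 0 < C ∧ ∀ y δ θ : ℝ, 1 ≤ y → 0 ≤ δ → 0 ≤ θ → θ ≤ 1 →
      |(1 - θ) * limitExcess y + θ * limitExcess (y + δ) - limitExcess (y + θ * δ)| ≤
        C * ((1 + y) ^ M)⁻¹ * δ ^ 2 := by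
  obtain ⟨C, hC, h⟩ := exists_interpolation_gaussian_le (M + 3)
  have hS := summable_inv_succ_sq.tsum_pos (fun j => by positivity) 0 (by norm_num)
  refine ⟨C * ∑' k : ℕ, (((k : ℝ) + 1) ^ 2)⁻¹, by positivity, fun y δ θ hy hδ h0 h1 => ?_⟩
  have hs : ∀ x : ℝ, 0 < x → HasSum (fun j : ℕ => 2 * x * Real.exp (-(((j : ℝ) + 1) * x) ^ 2))
      (limitExcess x) := fun x hx => (summable_exp_neg_sq hx).hasSum.mul_left _
  have hy0 : 0 < y := by linarith
  have hθδ : 0 ≤ θ * δ := mul_nonneg h0 hδ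
  have hsum := (((hs y hy0).mul_left (1 - θ)).add ((hs (y + δ) (by linarith)).mul_left θ)).sub
    (hs (y + θ * δ) (by linarith))
  rw [← hsum.tsum_eq, ← Real.norm_eq_abs]
  have hg := (summable_inv_succ_sq.hasSum.mul_left (C * ((1 + y) ^ M)⁻¹ * δ ^ 2))
  refine (tsum_of_norm_bounded hg fun j => ?_).trans (le_of_eq ?_)
  swap
  · ring
  set c : ℝ := (j : ℝ) + 1 with hc
  have hc1 : 1 ≤ c := by rw [hc]; linarith [Nat.cast_nonneg (α := ℝ) j]
  have hc0 : 0 < c := by linarith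
  have h2 := h (c * y) (c * δ) θ (by positivity) (by positivity) h0 h1
  rw [show c * y + c * δ = c * (y + δ) by ring,
    show c * y + θ * (c * δ) = c * (y + θ * δ) by ring] at h2
  have e : (1 - θ) * (2 * (c * y) * Real.exp (-(c * y) ^ 2)) +
      θ * (2 * (c * (y + δ)) * Real.exp (-(c * (y + δ)) ^ 2)) -
      2 * (c * (y + θ * δ)) * Real.exp (-(c * (y + θ * δ)) ^ 2) =
      c * ((1 - θ) * (2 * y * Real.exp (-(c * y) ^ 2)) +
      θ * (2 * (y + δ) * Real.exp (-(c * (y + δ)) ^ 2)) -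
      2 * (y + θ * δ) * Real.exp (-(c * (y + θ * δ)) ^ 2)) := by ring
  rw [e, abs_mul, abs_of_pos hc0] at h2
  rw [Real.norm_eq_abs]
  refine le_of_mul_le_mul_left (h2.trans ?_) hc0
  have h3 : ((1 + c * y) ^ (M + 3))⁻¹ ≤ ((1 + y) ^ M * c ^ 3)⁻¹ := by
    apply inv_anti₀ (by positivity)
    rw [pow_add]
    gcongr
    · nlinarith
    · nlinarith
  calc C * ((1 + c * y) ^ (M + 3))⁻¹ * (c * δ) ^ 2
      ≤ C * ((1 + y) ^ M * c ^ 3)⁻¹ * (c * δ) ^ 2 := by gcongr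
    _ = c * (C * ((1 + y) ^ M)⁻¹ * δ ^ 2 * (c ^ 2)⁻¹) := by field_simp

/-- In the transformed series `√π - y` is interpolated exactly, and each other term is `exp (-1/x²)`
at `x = y/c` with `c = (k+1)π`, so the errors sum like `c⁻²`, uniformly down to `y = 0`. -/
theorem exists_interpolation_limitExcess_le_sq :
    ∃ C : ℝ, 0 < C ∧ ∀ y δ θ : ℝ, 0 < y → 0 ≤ δ → 0 ≤ θ → θ ≤ 1 →
      |(1 - θ) * limitExcess y + θ * limitExcess (y + δ) - limitExcess (y + θ * δ)| ≤
        C * δ ^ 2 := by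
  have hpi := Real.pi_pos
  obtain ⟨C, hC, h⟩ := exists_interpolation_exp_inv_sq_le
  have hS := summable_inv_succ_sq.tsum_pos (fun j => by positivity) 0 (by norm_num)
  refine ⟨2 * √Real.pi * (C * (Real.pi ^ 2)⁻¹ * ∑' k : ℕ, (((k : ℝ) + 1) ^ 2)⁻¹), by positivity,
    fun y δ θ hy hδ h0 h1 => ?_⟩
  have hθδ : 0 ≤ θ * δ := mul_nonneg h0 hδ
  have hs : ∀ x : ℝ, 0 < x →
      HasSum (fun k : ℕ => Real.exp (-(((k : ℝ) + 1) * (Real.pi / x)) ^ 2))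
      (∑' k : ℕ, Real.exp (-(((k : ℝ) + 1) * (Real.pi / x)) ^ 2)) := fun x hx =>
    (summable_exp_neg_sq (by positivity)).hasSum
  have hsum := (((hs y hy).mul_left (1 - θ)).add ((hs (y + δ) (by linarith)).mul_left θ)).sub
    (hs (y + θ * δ) (by linarith))
  rw [limitExcess_eq hy, limitExcess_eq (by linarith), limitExcess_eq (by linarith)]
  generalize (∑' k : ℕ, Real.exp (-(((k : ℝ) + 1) * (Real.pi / y)) ^ 2)) = A at *
  generalize (∑' k : ℕ, Real.exp (-(((k : ℝ) + 1) * (Real.pi / (y + δ))) ^ 2)) = A' at *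
  generalize (∑' k : ℕ, Real.exp (-(((k : ℝ) + 1) * (Real.pi / (y + θ * δ))) ^ 2)) = A'' at *
  rw [show (1 - θ) * (√Real.pi - y + 2 * √Real.pi * A) +
    θ * (√Real.pi - (y + δ) + 2 * √Real.pi * A') - (√Real.pi - (y + θ * δ) + 2 * √Real.pi * A'') =
    2 * √Real.pi * ((1 - θ) * A + θ * A' - A'') by ring, abs_mul,
    abs_of_nonneg (by positivity : 0 ≤ 2 * √Real.pi), mul_assoc (2 * √Real.pi)]
  gcongr
  rw [← hsum.tsum_eq, ← Real.norm_eq_abs]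
  have hg := (summable_inv_succ_sq.hasSum.mul_left (C * (Real.pi ^ 2)⁻¹ * δ ^ 2))
  refine (tsum_of_norm_bounded hg fun k => ?_).trans (le_of_eq ?_)
  swap
  · ring
  set c : ℝ := ((k : ℝ) + 1) * Real.pi with hc
  have hc0 : 0 < c := by positivity
  have h2 := h (y / c) (δ / c) θ (by positivity) (by positivity) h0 h1
  rw [← add_div, ← mul_div_assoc, ← add_div, inv_div, inv_div, inv_div] at h2
  rw [Real.norm_eq_abs]
  simp only [← mul_div_assoc, ← hc]
  refine h2.trans (le_of_eq ?_)
  rw [hc]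
  field_simp

theorem exists_interpolation_limitExcess_le (M : ℕ) :
    ∃ C : ℝ, 0 < C ∧ ∀ y δ θ : ℝ, 0 < y → 0 ≤ δ → 0 ≤ θ → θ ≤ 1 →
      |(1 - θ) * limitExcess y + θ * limitExcess (y + δ) - limitExcess (y + θ * δ)| ≤
        C * ((1 + y) ^ M)⁻¹ * δ ^ 2 := by
  obtain ⟨C, hC, h⟩ := exists_interpolation_limitExcess_le_of_one_le M
  obtain ⟨D, hD, h'⟩ := exists_interpolation_limitExcess_le_sq
  refine ⟨C + D * 2 ^ M, by positivity, fun y δ θ hy hδ h0 h1 => ?_⟩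
  rcases le_total 1 y with hy1 | hy1
  · refine (h y δ θ hy1 hδ h0 h1).trans ?_
    gcongr
    exact le_add_of_nonneg_right (by positivity)
  · refine (h' y δ θ hy hδ h0 h1).trans ?_
    gcongr
    rw [← div_eq_mul_inv, le_div_iff₀ (by positivity)]
    have : (1 + y) ^ M ≤ 2 ^ M := by gcongr; linarith
    nlinarith [pow_pos (two_pos (α := ℝ)) M]

/-! ### Mean excess at integer levels -/

/-- Replacing one factor `1 + (j+1)y` by `1 + jy` gives a telescoping sum. -/
theorem sum_range_inv_sq_le {y : ℝ} (hy : 0 < y) (N : ℕ) :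
    ∑ j ∈ Finset.range N, ((1 + ((j : ℝ) + 1) * y) ^ 2)⁻¹ ≤ y⁻¹ := by
  have key : ∀ j ∈ Finset.range N, ((1 + ((j : ℝ) + 1) * y) ^ 2)⁻¹ ≤
      y⁻¹ * ((1 + (j : ℝ) * y)⁻¹ - (1 + ((j + 1 : ℕ) : ℝ) * y)⁻¹) := by
    intro j _
    have e : y⁻¹ * ((1 + (j : ℝ) * y)⁻¹ - (1 + ((j + 1 : ℕ) : ℝ) * y)⁻¹) =
        ((1 + (j : ℝ) * y) * (1 + ((j : ℝ) + 1) * y))⁻¹ := by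
      push_cast
      field_simp
      ring
    rw [e]
    apply inv_anti₀ (by positivity)
    rw [sq]
    gcongr
    linarith
  refine (Finset.sum_le_sum key).trans ?_
  rw [← Finset.mul_sum, Finset.sum_range_sub' (fun j : ℕ => (1 + (j : ℝ) * y)⁻¹)]
  have : 0 ≤ (1 + (N : ℝ) * y)⁻¹ := by positivity
  have h2 := inv_pos.2 hy
  simp only [Nat.cast_zero, zero_mul, add_zero, inv_one]
  nlinarith

theorem hasSum_meanExcess_natCast (n : ℕ) {H : ℕ} (hH : 0 < H) :
    HasSum (fun j : ℕ => 2 * (H : ℝ) * binomRatio n ((j + 1) * H)) (meanExcess n H) := by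
  have h : HasSum (fun j : ℕ => binomRatio n ((j + 1) * H))
      (∑ j ∈ Finset.range n, binomRatio n ((j + 1) * H)) := by
    refine hasSum_sum_of_ne_finset_zero fun j hj => binomRatio_of_lt ?_
    rw [Finset.mem_range] at hj
    nlinarith
  rw [meanExcess_natCast n hH]
  refine (?_ : ∑ j ∈ Finset.range n, binomRatio n ((j + 1) * H) =
    ∑ j ∈ Finset.Icc 1 n, binomRatio n (j * H)) ▸ h.mul_left (2 * (H : ℝ))
  symm
  refine Finset.sum_nbij' (fun j => j - 1) (fun j => j + 1) ?_ ?_ ?_ ?_ ?_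
  · intro j hj; simp at hj ⊢; omega
  · intro j hj; simp at hj ⊢; omega
  · intro j hj; simp at hj ⊢; omega
  · intro j hj; simp
  · intro j hj
    rw [Finset.mem_Icc] at hj
    rw [Nat.sub_add_cancel hj.1]

/-- The local limit theorem is summed over `j`. Two of the `M + 2` powers pay for the summation,
which costs `√n/H` and reduces the prefactor `2H/n` to `2/√n`. -/
theorem exists_meanExcess_natCast_sub_le (M : ℕ) :
    ∃ C : ℝ, 0 < C ∧ ∀ n H : ℕ, 0 < n → 0 < H →
      |meanExcess n H - √n * limitExcess (H / √n)| ≤ C / √n * ((1 + H / √n) ^ M)⁻¹ := by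
  obtain ⟨C, hC, h⟩ := exists_binomRatio_sub_exp_le (M + 2)
  refine ⟨2 * C, by positivity, fun n H hn hH => ?_⟩
  have hn' : (0 : ℝ) < n := by exact_mod_cast hn
  have hH' : (0 : ℝ) < H := by exact_mod_cast hH
  have hy : 0 < (H : ℝ) / √n := by positivity
  set y : ℝ := (H : ℝ) / √n with hyd
  have hHy : (H : ℝ) = √n * y := by rw [hyd]; field_simp
  have h1 := hasSum_meanExcess_natCast n hH
  have h2 : HasSum (fun j : ℕ => 2 * (H : ℝ) * Real.exp (-(((j : ℝ) + 1) * y) ^ 2))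
      (√n * limitExcess y) := by
    have e : √n * limitExcess y =
        2 * (H : ℝ) * ∑' j : ℕ, Real.exp (-(((j : ℝ) + 1) * y) ^ 2) := by
      rw [limitExcess, hHy]
      ring
    rw [e]
    exact (summable_exp_neg_sq hy).hasSum.mul_left (2 * (H : ℝ))
  have hs := summable_of_sum_range_le (f := fun j : ℕ => ((1 + ((j : ℝ) + 1) * y) ^ 2)⁻¹)
    (fun j => by positivity) (sum_range_inv_sq_le hy)
  have hs' := Real.tsum_le_of_sum_range_le (f := fun j : ℕ => ((1 + ((j : ℝ) + 1) * y) ^ 2)⁻¹)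
    (fun j => by positivity) (sum_range_inv_sq_le hy)
  have hb := hs.hasSum.mul_left (2 * H * (C / n * ((1 + y) ^ M)⁻¹))
  rw [← (h1.sub h2).tsum_eq, ← Real.norm_eq_abs]
  refine (tsum_of_norm_bounded hb fun j => ?_).trans ?_
  · rw [Real.norm_eq_abs, ← mul_sub, abs_mul, abs_of_pos (by positivity : 0 < 2 * (H : ℝ)),
      mul_assoc (2 * (H : ℝ))]
    gcongr
    have h3 := h n ((j + 1) * H) hn
    have e : (((j + 1) * H : ℕ) : ℝ) / √n = ((j : ℝ) + 1) * y := by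
      rw [hyd]; push_cast; ring
    rw [e] at h3
    refine h3.trans ?_
    rw [mul_assoc (C / (n : ℝ)), ← mul_inv, pow_add]
    gcongr
    have : (0 : ℝ) ≤ j := by positivity
    nlinarith
  · calc 2 * H * (C / n * ((1 + y) ^ M)⁻¹) * ∑' j : ℕ, ((1 + ((j : ℝ) + 1) * y) ^ 2)⁻¹
        ≤ 2 * H * (C / n * ((1 + y) ^ M)⁻¹) * y⁻¹ := by gcongr
      _ = 2 * C / √n * ((1 + y) ^ M)⁻¹ := by
        rw [hHy]
        have : (n : ℝ) = √n * √n := (Real.mul_self_sqrt hn'.le).symm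
        rw [this]
        field_simp
        simp

/-! ### The mean range by Wallis' product -/

/-- The square of `4 ^ n / n.centralBinom` is the Wallis product `W n` times `2n + 1`. -/
theorem expectation_ran_sq_bounds (n : ℕ) :
    Real.pi * n ≤ (closedWalkExpectation n fun w => (w.ran : ℝ)) ^ 2 ∧
      (closedWalkExpectation n fun w => (w.ran : ℝ)) ^ 2 ≤ Real.pi * n + Real.pi / 2 := by
  have hpi := Real.pi_pos
  have e : (closedWalkExpectation n fun w => (w.ran : ℝ)) ^ 2 =
      Real.Wallis.W n * (2 * n + 1) := by
    rw [expectation_ran, Real.Wallis.W_eq_factorial_ratio]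
    have hc : (n.centralBinom : ℝ) = (2 * n).factorial / (n.factorial : ℝ) ^ 2 := by
      rw [Nat.centralBinom, Nat.cast_choose ℝ (by omega : n ≤ 2 * n), two_mul,
        Nat.add_sub_cancel, sq]
    have hf : ((2 * n).factorial : ℝ) ≠ 0 := by positivity
    have hf2 : (n.factorial : ℝ) ≠ 0 := by positivity
    rw [hc]
    have h4 : (2 : ℝ) ^ (4 * n) = (4 ^ n) ^ 2 := by
      rw [← pow_mul, show (4 : ℝ) = 2 ^ 2 by norm_num, ← pow_mul]; ring_nf
    rw [h4]
    field_simp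
  have h1 := Real.Wallis.W_le n
  have h2 := Real.Wallis.le_W n
  have hn : (0 : ℝ) ≤ n := Nat.cast_nonneg n
  rw [e]
  constructor
  · have : Real.pi * n ≤ (2 * n + 1) / (2 * n + 2) * (Real.pi / 2) * (2 * n + 1) := by
      rw [div_mul_eq_mul_div, div_mul_eq_mul_div, le_div_iff₀ (by positivity)]
      nlinarith
    exact this.trans (by gcongr)
  · nlinarith

theorem expectation_ran_nonneg (n : ℕ) : 0 ≤ closedWalkExpectation n fun w => (w.ran : ℝ) := by
  rw [expectation_ran]; positivity

theorem abs_expectation_ran_sub_le {n : ℕ} (hn : 0 < n) :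
    |(closedWalkExpectation n fun w => (w.ran : ℝ)) - √n * √Real.pi| ≤ 2 / √n := by
  obtain ⟨h1, h2⟩ := expectation_ran_sq_bounds n
  have h0 := expectation_ran_nonneg n
  set E := closedWalkExpectation n fun w => (w.ran : ℝ)
  have hn' : (0 : ℝ) < n := by exact_mod_cast hn
  have hs : 0 < √(n : ℝ) := Real.sqrt_pos.2 hn'
  have hs2 : √(n : ℝ) ^ 2 = n := Real.sq_sqrt hn'.le
  have hp2 : √Real.pi ^ 2 = Real.pi := Real.sq_sqrt Real.pi_pos.le
  have hp1 : 1 ≤ √Real.pi := Real.one_le_sqrt.2 (by linarith [Real.pi_gt_three])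
  have hle : √n * √Real.pi ≤ E := by
    refine le_of_sq_le_sq ?_ h0
    rw [mul_pow, hs2, hp2]; linarith
  rw [abs_of_nonneg (by linarith), le_div_iff₀ hs]
  have h3 : (E - √n * √Real.pi) * (E + √n * √Real.pi) ≤ Real.pi / 2 := by
    have : (E - √n * √Real.pi) * (E + √n * √Real.pi) = E ^ 2 - √n ^ 2 * √Real.pi ^ 2 := by ring
    rw [this, hs2, hp2]; linarith
  have h4 : √(n : ℝ) ≤ E + √n * √Real.pi := by nlinarith
  have := Real.pi_lt_four
  nlinarith

/-! ### Mean excess at real levels -/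

theorem expectation_add (n : ℕ) (X Y : SimpleWalk (2 * n) → ℝ) :
    closedWalkExpectation n (fun w => X w + Y w) =
      closedWalkExpectation n X + closedWalkExpectation n Y := by
  simp [closedWalkExpectation, Finset.sum_add_distrib, add_div]

theorem expectation_const_mul (n : ℕ) (c : ℝ) (X : SimpleWalk (2 * n) → ℝ) :
    closedWalkExpectation n (fun w => c * X w) = c * closedWalkExpectation n X := by
  simp [closedWalkExpectation, ← Finset.mul_sum, mul_div_assoc]

theorem closedSteps_card_pos (n : ℕ) : (0 : ℝ) < (closedSteps n).card := by
  rw [card_closedSteps]; exact_mod_cast n.centralBinom_pos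

theorem expectation_const (n : ℕ) (c : ℝ) : closedWalkExpectation n (fun _ => c) = c := by
  have := (closedSteps_card_pos n).ne'
  simp [closedWalkExpectation, this]

theorem meanExcess_of_le_one (n : ℕ) {t : ℝ} (ht : t ≤ 1) :
    meanExcess n t = (closedWalkExpectation n fun w => (w.ran : ℝ)) - t := by
  rw [sub_eq_add_neg, ← expectation_const n (-t), ← expectation_add]
  unfold meanExcess closedWalkExpectation
  congr 1
  refine Finset.sum_congr rfl fun s hs => ?_
  have : (1 : ℝ) ≤ (mk 0 s).ran := by exact_mod_cast one_le_ran n hs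
  dsimp only
  rw [max_eq_left (by linarith)]
  ring

/-- The range is an integer, so `(R - t)⁺` is affine in `t` on `[H, H + 1]`. -/
theorem meanExcess_interpolation (n H : ℕ) {θ : ℝ} (h0 : 0 ≤ θ) (h1 : θ ≤ 1) :
    meanExcess n (H + θ) = (1 - θ) * meanExcess n H + θ * meanExcess n (H + 1 : ℕ) := by
  unfold meanExcess
  rw [← expectation_const_mul, ← expectation_const_mul, ← expectation_add]
  congr 1
  ext w
  rcases le_or_gt w.ran H with h | h
  · have : (w.ran : ℝ) ≤ H := by exact_mod_cast h
    push_cast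
    rw [max_eq_right (by linarith), max_eq_right (by linarith), max_eq_right (by linarith)]
    ring
  · have : (H : ℝ) + 1 ≤ w.ran := by exact_mod_cast h
    push_cast
    rw [max_eq_left (by linarith), max_eq_left (by linarith), max_eq_left (by linarith)]
    ring

/-- The mean excess of the range is close to its scaling limit. -/
theorem exists_meanExcess_sub_le (M : ℕ) :
    ∃ C : ℝ, 0 < C ∧ ∀ (n : ℕ) (t : ℝ), 0 < n → 0 < t →
      |meanExcess n t - √n * limitExcess (t / √n)| ≤ C / √n * ((1 + t / √n) ^ M)⁻¹ := by
  obtain ⟨A, hA, hA'⟩ := exists_limitExcess_sub_le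
  obtain ⟨B, hB, hB'⟩ := exists_meanExcess_natCast_sub_le M
  obtain ⟨D, hD, hD'⟩ := exists_interpolation_limitExcess_le M
  refine ⟨(2 + A + B + D) * 2 ^ M, by positivity, fun n t hn ht => ?_⟩
  have hn' : (0 : ℝ) < n := by exact_mod_cast hn
  have hn1 : (1 : ℝ) ≤ n := by exact_mod_cast hn
  have hs : 0 < √(n : ℝ) := Real.sqrt_pos.2 hn'
  have hs1 : 1 ≤ √(n : ℝ) := Real.one_le_sqrt.2 hn1
  -- Below `1` the floor may be `0`, where the integer estimate is not available; there the excess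
  -- is exactly `E R - t` and matches `√π - y` after scaling.
  rcases le_total t 1 with ht1 | ht1
  · have h1 := abs_expectation_ran_sub_le hn
    have h2 := hA' (t / √n) (by positivity)
    rw [meanExcess_of_le_one n ht1]
    set E := closedWalkExpectation n fun w => (w.ran : ℝ)
    have e : E - t - √n * limitExcess (t / √n) =
        (E - √n * √Real.pi) - √n * (limitExcess (t / √n) - (√Real.pi - t / √n)) := by
      field_simp
      ring
    have h3 : √n * (A * (t / √n) ^ 2) ≤ A / √n := by
      rw [le_div_iff₀ hs]
      have : √n * (A * (t / √n) ^ 2) * √n = A * t ^ 2 := by field_simp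
      rw [this]
      exact mul_le_of_le_one_right hA.le (pow_le_one₀ ht.le ht1)
    have h4 : |E - t - √n * limitExcess (t / √n)| ≤ (2 + A) / √n := by
      rw [e]
      refine (abs_sub _ _).trans ?_
      rw [abs_mul, abs_of_pos hs, add_div]
      refine add_le_add h1 (le_trans ?_ h3)
      gcongr
    refine h4.trans ?_
    have h5 : (1 + t / √n) ^ M ≤ 2 ^ M := by
      gcongr
      have : t / √n ≤ 1 := by rw [div_le_one hs]; linarith
      linarith
    rw [← div_eq_mul_inv, le_div_iff₀ (by positivity), div_mul_eq_mul_div]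
    have h6 : (2 + A) * (1 + t / √n) ^ M ≤ (2 + A + B + D) * 2 ^ M :=
      mul_le_mul (by linarith) h5 (by positivity) (by positivity)
    gcongr
  · set H := ⌊t⌋₊ with hH
    have hH1 : 1 ≤ H := Nat.le_floor (by simpa using ht1)
    have hHt : (H : ℝ) ≤ t := Nat.floor_le ht.le
    have htH : t < H + 1 := Nat.lt_floor_add_one t
    have hH1' : (1 : ℝ) ≤ H := by exact_mod_cast hH1
    have h0 : 0 ≤ t - H := by linarith
    have h1 : t - H ≤ 1 := by linarith
    have hy : 0 < (H : ℝ) / √n := by positivity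
    have hi := meanExcess_interpolation n H h0 h1
    rw [add_sub_cancel] at hi
    have b1 := hB' n H hn hH1
    have b2 := hB' n (H + 1) hn (by omega)
    have b3 := hD' (H / √n) (1 / √n) (t - H) hy (by positivity) h0 h1
    have e1 : (H : ℝ) / √n + 1 / √n = ((H + 1 : ℕ) : ℝ) / √n := by push_cast; ring
    have e2 : (H : ℝ) / √n + (t - H) * (1 / √n) = t / √n := by ring
    rw [e1, e2] at b3
    set θ := t - H
    set K := ((1 + (H : ℝ) / √n) ^ M)⁻¹ with hK
    have hK0 : 0 ≤ K := by positivity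
    have hK2 : ((1 + ((H + 1 : ℕ) : ℝ) / √n) ^ M)⁻¹ ≤ K := by
      rw [hK]
      gcongr
      linarith
    -- As `H ≥ 1`, `t ≤ 2H`, so passing from `H` to `t` in the decay factor costs `2 ^ M`.
    have hK3 : K ≤ 2 ^ M * ((1 + t / √n) ^ M)⁻¹ := by
      rw [hK, ← div_eq_mul_inv, inv_le_comm₀ (by positivity) (by positivity), inv_div,
        div_le_iff₀ (by positivity), ← mul_pow]
      gcongr
      have : t / √n ≤ 2 * H / √n := by gcongr; linarith
      rw [mul_div_assoc] at this
      linarith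
    have b2' : |meanExcess n (H + 1 : ℕ) - √n * limitExcess ((H + 1 : ℕ) / √n)| ≤ B / √n * K :=
      b2.trans (by gcongr)
    have b3' : D * K * (1 / √n) ^ 2 * √n = D / √n * K := by field_simp
    rw [hi]
    set P := meanExcess n H
    set P' := meanExcess n (H + 1 : ℕ)
    set L := limitExcess (H / √n)
    set L' := limitExcess ((H + 1 : ℕ) / √n)
    set L'' := limitExcess (t / √n)
    have e : (1 - θ) * P + θ * P' - √n * L'' = (1 - θ) * (P - √n * L) + θ * (P' - √n * L') +
        ((1 - θ) * L + θ * L' - L'') * √n := by ring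
    have b4 : |((1 - θ) * L + θ * L' - L'') * √n| ≤ D / √n * K := by
      rw [abs_mul, abs_of_pos hs, ← b3']
      gcongr
    have b5 : |(1 - θ) * (P - √n * L)| ≤ (1 - θ) * (B / √n * K) := by
      rw [abs_mul, abs_of_nonneg (by linarith)]
      gcongr
    have b6 : |θ * (P' - √n * L')| ≤ θ * (B / √n * K) := by
      rw [abs_mul, abs_of_nonneg h0]
      gcongr
    have b7 : |(1 - θ) * P + θ * P' - √n * L''| ≤ (B + D) / √n * K := by
      rw [e]
      refine (abs_add_le _ _).trans ((add_le_add (abs_add_le _ _) le_rfl).trans ?_)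
      have : (B + D) / √n * K = B / √n * K + D / √n * K := by ring
      rw [this]
      linarith
    calc _ ≤ (B + D) / √n * K := b7
      _ ≤ (B + D) / √n * (2 ^ M * ((1 + t / √n) ^ M)⁻¹) := by gcongr
      _ = (B + D) * 2 ^ M / √n * ((1 + t / √n) ^ M)⁻¹ := by ring
      _ ≤ _ := by gcongr; linarith

/-! ### Moments of the range -/

theorem integrableOn_pow_mul_max (k : ℕ) (x : ℝ) :
    MeasureTheory.IntegrableOn (fun y : ℝ => y ^ k * max (x - y) 0) (Set.Ioi 0) := by
  have h : MeasureTheory.IntegrableOn (fun y : ℝ => y ^ k * max (x - y) 0) (Set.Ioc 0 x) :=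
    (Continuous.integrableOn_Icc (by fun_prop)).mono_set Set.Ioc_subset_Icc_self
  refine h.of_forall_sdiff_eq_zero measurableSet_Ioi fun y hy => ?_
  have : x < y := by
    by_contra hc
    exact hy.2 ⟨hy.1, not_lt.1 hc⟩
  rw [max_eq_right (by linarith), mul_zero]

theorem integral_pow_mul_max (k : ℕ) {x : ℝ} (hx : 0 ≤ x) :
    ((k : ℝ) + 2) * (k + 1) * ∫ y in Set.Ioi (0 : ℝ), y ^ k * max (x - y) 0 = x ^ (k + 2) := by
  have h1 : ∫ y in Set.Ioi (0 : ℝ), y ^ k * max (x - y) 0 =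
      ∫ y in Set.Ioc 0 x, y ^ k * max (x - y) 0 := by
    refine (MeasureTheory.setIntegral_eq_of_subset_of_forall_sdiff_eq_zero measurableSet_Ioi
      (fun y hy => hy.1) fun y hy => ?_)
    have : x < y := by
      by_contra hc
      exact hy.2 ⟨hy.1, not_lt.1 hc⟩
    rw [max_eq_right (by linarith), mul_zero]
  have h2 : ∫ y in Set.Ioc 0 x, y ^ k * max (x - y) 0 =
      ∫ y in Set.Ioc 0 x, (x * y ^ k - y ^ (k + 1)) := by
    refine MeasureTheory.setIntegral_congr_fun measurableSet_Ioc fun y hy => ?_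
    have := hy.2
    rw [max_eq_left (by linarith)]
    ring
  rw [h1, h2, ← intervalIntegral.integral_of_le hx, intervalIntegral.integral_sub,
    intervalIntegral.integral_const_mul, integral_pow, integral_pow]
  · push_cast
    simp only [ne_eq, Nat.add_eq_zero_iff, one_ne_zero, and_false, not_false_eq_true, zero_pow,
      sub_zero]
    field_simp
    ring
  · exact (Continuous.intervalIntegrable (by fun_prop) _ _)
  · exact (Continuous.intervalIntegrable (by fun_prop) _ _)

theorem pow_mul_meanExcess_eq {n : ℕ} (hn : 0 < n) (k : ℕ) (y : ℝ) :
    y ^ k * meanExcess n (√n * y) = closedWalkExpectation n fun w =>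
      √n * (y ^ k * max ((w.ran : ℝ) / √n - y) 0) := by
  have hs : 0 < √(n : ℝ) := Real.sqrt_pos.2 (by exact_mod_cast hn)
  rw [meanExcess, ← expectation_const_mul]
  congr 1
  ext w
  rw [mul_left_comm, mul_max_of_nonneg _ _ hs.le, mul_sub, mul_div_cancel₀ _ hs.ne', mul_zero]

theorem integrableOn_pow_mul_meanExcess {n : ℕ} (hn : 0 < n) (k : ℕ) :
    MeasureTheory.IntegrableOn (fun y : ℝ => y ^ k * meanExcess n (√n * y)) (Set.Ioi 0) := by
  simp only [pow_mul_meanExcess_eq hn, closedWalkExpectation]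
  refine MeasureTheory.Integrable.div_const ?_ _
  exact MeasureTheory.integrable_finsetSum _ fun s _ =>
    (integrableOn_pow_mul_max k _).const_mul _

/-- The moments of the range are the moments of its mean excess. -/
theorem expectation_ran_pow {n : ℕ} (hn : 0 < n) (k : ℕ) :
    closedWalkExpectation n (fun w => (w.ran : ℝ) ^ (k + 2)) = ((k : ℝ) + 2) * (k + 1) *
      √n ^ (k + 1) * ∫ y in Set.Ioi (0 : ℝ), y ^ k * meanExcess n (√n * y) := by
  have hs : 0 < √(n : ℝ) := Real.sqrt_pos.2 (by exact_mod_cast hn)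
  simp only [pow_mul_meanExcess_eq hn, closedWalkExpectation]
  rw [MeasureTheory.integral_div, MeasureTheory.integral_finsetSum, mul_div_assoc', Finset.mul_sum]
  · congr 1
    refine Finset.sum_congr rfl fun s _ => ?_
    have h := integral_pow_mul_max k (x := (mk 0 s).ran / √n) (by positivity)
    rw [MeasureTheory.integral_const_mul]
    rw [div_pow, eq_div_iff (by positivity)] at h
    rw [← h]
    ring
  · exact fun s _ => (integrableOn_pow_mul_max k _).const_mul _

theorem integral_pow_mul_gaussian (k j : ℕ) :
    ∫ y in Set.Ioi (0 : ℝ), y ^ k * (2 * y * Real.exp (-(((j : ℝ) + 1) * y) ^ 2)) =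
      (((j : ℝ) + 1) ^ (k + 2))⁻¹ * Real.Gamma (((k : ℝ) + 2) / 2) := by
  have hc : (0 : ℝ) < (j : ℝ) + 1 := by positivity
  have h := integral_rpow_mul_exp_neg_mul_rpow (p := 2) (q := (k : ℝ) + 1) (b := ((j : ℝ) + 1) ^ 2)
    two_pos (by linarith [Nat.cast_nonneg (α := ℝ) k]) (by positivity)
  have e : ∀ y ∈ Set.Ioi (0 : ℝ), y ^ k * (2 * y * Real.exp (-(((j : ℝ) + 1) * y) ^ 2)) =
      2 * (y ^ ((k : ℝ) + 1) * Real.exp (-((j : ℝ) + 1) ^ 2 * y ^ (2 : ℝ))) := by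
    intro y hy
    have e1 : y ^ ((k : ℝ) + 1) = y ^ (k + 1) := by
      rw [← Real.rpow_natCast]; push_cast; rfl
    rw [e1, Real.rpow_two, mul_pow, neg_mul]
    ring
  rw [MeasureTheory.setIntegral_congr_fun measurableSet_Ioi e, MeasureTheory.integral_const_mul, h]
  have e2 : (((j : ℝ) + 1) ^ 2) ^ (-((k : ℝ) + 1 + 1) / 2) = (((j : ℝ) + 1) ^ (k + 2))⁻¹ := by
    rw [← Real.rpow_natCast _ 2, ← Real.rpow_mul hc.le, ← Real.rpow_natCast _ (k + 2),
      ← Real.rpow_neg hc.le]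
    congr 1
    push_cast
    ring
  rw [e2, show (k : ℝ) + 1 + 1 = k + 2 by ring]
  ring

theorem integrableOn_pow_mul_gaussian (k j : ℕ) :
    MeasureTheory.IntegrableOn
      (fun y : ℝ => y ^ k * (2 * y * Real.exp (-(((j : ℝ) + 1) * y) ^ 2))) (Set.Ioi 0) := by
  -- The integral of a non-integrable function is `0` by convention, so a nonzero value proves
  -- integrability.
  refine MeasureTheory.Integrable.of_integral_ne_zero ?_
  rw [integral_pow_mul_gaussian]
  have := Real.Gamma_pos_of_pos (by positivity : (0 : ℝ) < ((k : ℝ) + 2) / 2)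
  positivity

theorem summable_inv_succ_pow (k : ℕ) : Summable fun j : ℕ => (((j : ℝ) + 1) ^ (k + 2))⁻¹ := by
  have := (summable_nat_add_iff 1).2
    (Real.summable_nat_pow_inv (p := k + 2).2 (by omega))
  simpa using this

theorem tsum_inv_succ_pow_pos (k : ℕ) : 0 < ∑' j : ℕ, (((j : ℝ) + 1) ^ (k + 2))⁻¹ :=
  (summable_inv_succ_pow k).tsum_pos (fun j => by positivity) 0 (by norm_num)

/-- Termwise Mellin transform of the theta series; the terms are nonnegative on the domain, so
summability of their integrals justifies the exchange. -/
theorem integral_pow_mul_limitExcess (k : ℕ) :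
    ∫ y in Set.Ioi (0 : ℝ), y ^ k * limitExcess y =
      (∑' j : ℕ, (((j : ℝ) + 1) ^ (k + 2))⁻¹) * Real.Gamma (((k : ℝ) + 2) / 2) := by
  have h := MeasureTheory.hasSum_integral_of_summable_integral_norm
    (F := fun (j : ℕ) (y : ℝ) => y ^ k * (2 * y * Real.exp (-(((j : ℝ) + 1) * y) ^ 2)))
    (μ := MeasureTheory.volume.restrict (Set.Ioi 0))
    (fun j => integrableOn_pow_mul_gaussian k j) ?_
  · have e : ∀ y : ℝ, ∑' j : ℕ, y ^ k * (2 * y * Real.exp (-(((j : ℝ) + 1) * y) ^ 2)) =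
        y ^ k * limitExcess y := by
      intro y
      rw [tsum_mul_left, tsum_mul_left, limitExcess]
    simp only [integral_pow_mul_gaussian, e] at h
    exact h.unique ((summable_inv_succ_pow k).hasSum.mul_right _)
  · have e : ∀ j : ℕ, ∫ y in Set.Ioi (0 : ℝ),
        ‖y ^ k * (2 * y * Real.exp (-(((j : ℝ) + 1) * y) ^ 2))‖ =
        (((j : ℝ) + 1) ^ (k + 2))⁻¹ * Real.Gamma (((k : ℝ) + 2) / 2) := by
      intro j
      rw [← integral_pow_mul_gaussian]
      refine MeasureTheory.setIntegral_congr_fun measurableSet_Ioi fun y hy => ?_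
      have : (0 : ℝ) < y := hy
      exact Real.norm_of_nonneg (by positivity)
    simp only [e]
    exact (summable_inv_succ_pow k).mul_right _

theorem integrableOn_pow_mul_limitExcess (k : ℕ) :
    MeasureTheory.IntegrableOn (fun y : ℝ => y ^ k * limitExcess y) (Set.Ioi 0) := by
  refine MeasureTheory.Integrable.of_integral_ne_zero ?_
  rw [integral_pow_mul_limitExcess]
  have := Real.Gamma_pos_of_pos (by positivity : (0 : ℝ) < ((k : ℝ) + 2) / 2)
  have := tsum_inv_succ_pow_pos k
  positivity

/-- The leading coefficient of the moment of order `k + 2` of the range. -/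
noncomputable def momentCoeff (k : ℕ) : ℝ :=
  ((k : ℝ) + 2) * (k + 1) *
    ((∑' j : ℕ, (((j : ℝ) + 1) ^ (k + 2))⁻¹) * Real.Gamma (((k : ℝ) + 2) / 2))

theorem momentCoeff_pos (k : ℕ) : 0 < momentCoeff k := by
  have := Real.Gamma_pos_of_pos (by positivity : (0 : ℝ) < ((k : ℝ) + 2) / 2)
  have := tsum_inv_succ_pow_pos k
  unfold momentCoeff
  positivity

/-- Decay of order `k + 2` makes `y ^ k` times the error integrable, dominated by `(C/√n) / (1 +
y²)`. The prefactor `√n ^ (k+1)` then leaves an error two powers of `√n` below the main term. -/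
theorem exists_expectation_ran_pow_sub_le (k : ℕ) :
    ∃ C : ℝ, 0 < C ∧ ∀ n : ℕ, 0 < n →
      |closedWalkExpectation n (fun w => (w.ran : ℝ) ^ (k + 2)) - momentCoeff k * √n ^ (k + 2)| ≤
        C * √n ^ k := by
  obtain ⟨C, hC, h⟩ := exists_meanExcess_sub_le (k + 2)
  set J := ∫ y in Set.Ioi (0 : ℝ), (1 + y ^ 2)⁻¹ with hJ
  have hJ0 : 0 ≤ J := MeasureTheory.integral_nonneg fun y => by positivity
  refine ⟨((k : ℝ) + 2) * (k + 1) * C * (J + 1), by positivity, fun n hn => ?_⟩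
  have hs : 0 < √(n : ℝ) := Real.sqrt_pos.2 (by exact_mod_cast hn)
  have hint := integrableOn_pow_mul_meanExcess hn k
  have hlim := (integrableOn_pow_mul_limitExcess k).const_mul √(n : ℝ)
  have e : closedWalkExpectation n (fun w => (w.ran : ℝ) ^ (k + 2)) -
      momentCoeff k * √n ^ (k + 2) = ((k : ℝ) + 2) * (k + 1) * √n ^ (k + 1) *
        ∫ y in Set.Ioi (0 : ℝ), (y ^ k * meanExcess n (√n * y) - √n * (y ^ k * limitExcess y)) := by
    rw [MeasureTheory.integral_sub hint hlim, MeasureTheory.integral_const_mul,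
      integral_pow_mul_limitExcess, expectation_ran_pow hn, momentCoeff]
    ring
  have hb : |∫ y in Set.Ioi (0 : ℝ),
      (y ^ k * meanExcess n (√n * y) - √n * (y ^ k * limitExcess y))| ≤ C / √n * J := by
    rw [hJ, ← MeasureTheory.integral_const_mul, ← Real.norm_eq_abs]
    refine MeasureTheory.norm_integral_le_of_norm_le
      (integrable_inv_one_add_sq.integrableOn.const_mul _) ?_
    refine (MeasureTheory.ae_restrict_iff' measurableSet_Ioi).2 (Eventually.of_forall ?_)
    intro y hy
    have hy0 : (0 : ℝ) < y := hy
    have h1 := h n (√n * y) hn (by positivity)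
    rw [mul_div_cancel_left₀ _ hs.ne'] at h1
    rw [Real.norm_eq_abs, mul_left_comm, ← mul_sub, abs_mul, abs_of_pos (by positivity)]
    calc y ^ k * |meanExcess n (√n * y) - √n * limitExcess y|
        ≤ (1 + y) ^ k * (C / √n * ((1 + y) ^ (k + 2))⁻¹) := by
          gcongr
          linarith
      _ = C / √n * ((1 + y) ^ 2)⁻¹ := by
          rw [pow_add]; field_simp
      _ ≤ C / √n * (1 + y ^ 2)⁻¹ := by
          gcongr
          nlinarith
  rw [e, abs_mul, abs_of_pos (by positivity)]
  calc _ ≤ ((k : ℝ) + 2) * (k + 1) * √n ^ (k + 1) * (C / √n * J) := by gcongr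
    _ = ((k : ℝ) + 2) * (k + 1) * C * J * √n ^ k := by rw [pow_succ]; field_simp
    _ ≤ _ := by gcongr; linarith

theorem exists_expectation_ran_pow_const_sub_le (r : ℕ) :
    ∃ C : ℝ, 0 < C ∧ ∀ n : ℕ, 0 < n →
      |(closedWalkExpectation n fun w => (w.ran : ℝ)) ^ (r + 2) - (√n * √Real.pi) ^ (r + 2)| ≤
        C * √n ^ r := by
  refine ⟨2 * (r + 2) * 4 ^ (r + 1), by positivity, fun n hn => ?_⟩
  have hn1 : (1 : ℝ) ≤ n := by exact_mod_cast hn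
  have hs1 : 1 ≤ √(n : ℝ) := Real.one_le_sqrt.2 hn1
  have hs : 0 < √(n : ℝ) := by linarith
  have h1 := abs_expectation_ran_sub_le hn
  have h0 := expectation_ran_nonneg n
  set E := closedWalkExpectation n fun w => (w.ran : ℝ)
  have hp : √Real.pi ≤ 2 := Real.sqrt_le_iff.2 ⟨by norm_num, by linarith [Real.pi_lt_four]⟩
  have hP : √n * √Real.pi ≤ 4 * √n := by nlinarith
  have hE : E ≤ 4 * √n := by
    have h2 : 2 / √(n : ℝ) ≤ 2 * √n := by rw [div_le_iff₀ hs]; nlinarith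
    have := (abs_le.1 h1).2
    nlinarith
  -- Mean value estimate: a gap of `2/√n` between two numbers at most `4√n`.
  refine (abs_pow_sub_pow_le E (√n * √Real.pi) (r + 2)).trans ?_
  rw [abs_of_nonneg h0, abs_of_nonneg (by positivity : 0 ≤ √n * √Real.pi)]
  calc |E - √n * √Real.pi| * ((r + 2 : ℕ) : ℝ) * max E (√n * √Real.pi) ^ (r + 2 - 1)
      ≤ 2 / √n * ((r + 2 : ℕ) : ℝ) * (4 * √n) ^ (r + 1) := by
        rw [show r + 2 - 1 = r + 1 by omega]
        gcongr
        exact max_le hE hP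
    _ = _ := by push_cast; rw [mul_pow, pow_succ √(n : ℝ)]; field_simp

/-! ### Identification with `ξ` and conclusion -/

theorem riemannXi_natCast_add_two (k : ℕ) :
    riemannXi ((k + 2 : ℕ) : ℂ) = ((momentCoeff k / √Real.pi ^ (k + 2) : ℝ) : ℂ) := by
  rw [riemannXi_natCast (by omega), xiFormula, zeta_nat_eq_tsum_of_gt_one (by omega)]
  have h1 : ∑' j : ℕ, 1 / (j : ℂ) ^ (k + 2) =
      ((∑' j : ℕ, (((j : ℝ) + 1) ^ (k + 2))⁻¹ : ℝ) : ℂ) := by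
    have hs : Summable fun j : ℕ => ((j : ℝ) ^ (k + 2))⁻¹ :=
      Real.summable_nat_pow_inv.2 (by omega)
    -- The term `j = 0` of the zeta series is `1/0 = 0` by convention and drops out.
    have h2 := hs.tsum_eq_zero_add
    simp only [Nat.cast_zero, ne_eq, Nat.add_eq_zero_iff, OfNat.ofNat_ne_zero, and_false,
      not_false_eq_true, zero_pow, inv_zero, zero_add, Nat.cast_add, Nat.cast_one] at h2
    rw [← h2]
    push_cast
    simp
  have h3 : Complex.Gamma (((k + 2 : ℕ) : ℂ) / 2) = (Real.Gamma (((k : ℝ) + 2) / 2) : ℂ) := by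
    rw [← Complex.Gamma_ofReal]
    push_cast
    rfl
  have h4 : (Real.pi : ℂ) ^ (-((k + 2 : ℕ) : ℂ) / 2) = (((√Real.pi ^ (k + 2))⁻¹ : ℝ) : ℂ) := by
    have e : (√Real.pi ^ (k + 2))⁻¹ = Real.pi ^ (-((k + 2 : ℕ) : ℝ) / 2) := by
      rw [Real.sqrt_eq_rpow, ← Real.rpow_natCast, ← Real.rpow_mul Real.pi_pos.le,
        ← Real.rpow_neg Real.pi_pos.le]
      congr 1
      ring
    rw [e, Complex.ofReal_cpow Real.pi_pos.le]
    push_cast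
    rfl
  rw [h1, h3, h4, momentCoeff, div_eq_mul_inv]
  push_cast
  ring

theorem expectation_ran_pos (n : ℕ) : 0 < closedWalkExpectation n fun w => (w.ran : ℝ) := by
  have : (0 : ℝ) < n.centralBinom := by exact_mod_cast n.centralBinom_pos
  rw [expectation_ran]
  positivity

theorem exists_moment_ratio (k : ℕ) :
    ∃ ε : ℕ → ℝ, ε =O[atTop] (fun n : ℕ => 1 / (n : ℝ)) ∧ ∀ n : ℕ,
      closedWalkExpectation n (fun w => (w.ran : ℝ) ^ (k + 2)) =
        momentCoeff k / √Real.pi ^ (k + 2) *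
          (closedWalkExpectation n fun w => (w.ran : ℝ)) ^ (k + 2) * (1 + ε n) := by
  have hK := momentCoeff_pos k
  have hpi : 0 < √Real.pi := Real.sqrt_pos.2 Real.pi_pos
  obtain ⟨A, hA, hA'⟩ := exists_expectation_ran_pow_sub_le k
  obtain ⟨B, hB, hB'⟩ := exists_expectation_ran_pow_const_sub_le k
  set X := momentCoeff k / √Real.pi ^ (k + 2) with hX
  have hX0 : 0 < X := by positivity
  -- With `ε` chosen as the relative error the identity is exact for every `n`, since the mean is
  -- positive; only its size needs asymptotics.
  refine ⟨fun n => (closedWalkExpectation n (fun w => (w.ran : ℝ) ^ (k + 2)) -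
    X * (closedWalkExpectation n fun w => (w.ran : ℝ)) ^ (k + 2)) /
      (X * (closedWalkExpectation n fun w => (w.ran : ℝ)) ^ (k + 2)), ?_, fun n => ?_⟩
  · refine IsBigO.of_bound ((A + X * B) / (X * √Real.pi ^ (k + 2))) ?_
    filter_upwards [eventually_gt_atTop 0] with n hn
    have hn' : (0 : ℝ) < n := by exact_mod_cast hn
    have hs : 0 < √(n : ℝ) := Real.sqrt_pos.2 hn'
    have hE := expectation_ran_pos n
    have h1 := hA' n hn
    have h2 := hB' n hn
    have h3 : √n * √Real.pi ≤ closedWalkExpectation n fun w => (w.ran : ℝ) := by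
      refine le_of_sq_le_sq ?_ hE.le
      rw [mul_pow, Real.sq_sqrt hn'.le, Real.sq_sqrt Real.pi_pos.le]
      linarith [(expectation_ran_sq_bounds n).1]
    set E := closedWalkExpectation n fun w => (w.ran : ℝ)
    set m := closedWalkExpectation n (fun w => (w.ran : ℝ) ^ (k + 2))
    have hXp : momentCoeff k * √n ^ (k + 2) = X * (√n * √Real.pi) ^ (k + 2) := by
      rw [hX, mul_pow]; field_simp
    have h4 : |m - X * E ^ (k + 2)| ≤ (A + X * B) * √n ^ k := by
      have e : m - X * E ^ (k + 2) = (m - momentCoeff k * √n ^ (k + 2)) -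
          X * (E ^ (k + 2) - (√n * √Real.pi) ^ (k + 2)) := by rw [hXp]; ring
      rw [e]
      refine (abs_sub _ _).trans ?_
      rw [abs_mul, abs_of_pos hX0]
      have := mul_le_mul_of_nonneg_left h2 hX0.le
      linarith
    rw [Real.norm_eq_abs, abs_div, abs_of_pos (by positivity : 0 < X * E ^ (k + 2)),
      Real.norm_of_nonneg (by positivity)]
    calc |m - X * E ^ (k + 2)| / (X * E ^ (k + 2))
        ≤ (A + X * B) * √n ^ k / (X * (√n * √Real.pi) ^ (k + 2)) := by gcongr
      _ = _ := by
        have e : (n : ℝ) = √n ^ 2 := (Real.sq_sqrt hn'.le).symm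
        rw [mul_pow, pow_add √(n : ℝ), ← e]
        field_simp
  · have hE := expectation_ran_pos n
    field_simp
    ring

theorem mainTheorem8 (r : ℕ) :
    ∃ ε : ℕ → ℝ, ε =O[atTop] (fun n : ℕ => 1 / (n : ℝ)) ∧
      ∀ n : ℕ,
        ((closedWalkExpectation n (fun w => (w.ran : ℝ) ^ r) : ℝ) : ℂ) =
          riemannXi (r : ℂ) *
            ((closedWalkExpectation n (fun w => (w.ran : ℝ)) : ℝ) : ℂ) ^ r *
              (1 + (ε n : ℂ)) := by
  match r with
  -- For `r = 0` and `r = 1` the factor `s(s - 1)` vanishes, so `ξ = 1` and the identity holds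
  -- without error.
  | 0 =>
    refine ⟨0, isBigO_zero _ _, fun n => ?_⟩
    simp [riemannXi_eq, expectation_const]
  | 1 =>
    refine ⟨0, isBigO_zero _ _, fun n => ?_⟩
    simp [riemannXi_eq]
  | k + 2 =>
    obtain ⟨ε, hε, h⟩ := exists_moment_ratio k
    refine ⟨ε, hε, fun n => ?_⟩
    rw [riemannXi_natCast_add_two, h n]
    push_cast
    ring
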